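/- Let $k\ge 1$ and let $F(n)=\prod_{j=1}^k(a_jn+b_j)$ with $a_j,b_j\in\mathbb Z$, $a_j\neq0$, and $\prod_{i<j}(a_ib_j-a_jb_i)\neq0$. For $q\ge1$ put $X_q=\{n\in\mathbb Z/q\mathbb Z:(q,F(n))=1\}$ and $\gamma(q)=|X_q|/q$, and assume $\gamma(q)>0$ for all $q\ge1$. Write $e(\theta)=e^{2\pi i\theta}$ and $\mathbb E_{1\le n\le N}f(n)=\frac1N\sum_{n=1}^Nf(n)$, and for an integer $R\ge1$ define $$s(r/q)=\frac1{|X_q|}\sum_{n\in X_q}e(rn/q),\qquad \alpha_R(n)=\sum_{q\le R}\ \sum_{r\in(\mathbb Z/q\mathbb Z)^*}s(r/q)\,e(-rn/q),$$ $$G(R)=\sum_{q\le R}\mu(q)^2\prod_{\substack{\ell\mid q\\ \ell\text{ prime}}}\frac{1-\gamma(\ell)}{\gamma(\ell)},\qquad \beta_R(n)=\frac{|\alpha_R(n)|^2}{G(R)}\qquad(n\in\mathbb Z),$$ so that $\beta_R\ge0$ is the enveloping sieve attached to $F$. **Proposition ($L^p$ extension estimate for $\beta_R$).** Let $p>2$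 be real, $k\ge1$ an integer and $A>0$. There is a constant $C=C(p,k,A)>0$ such that the following holds. Let $N,R\ge1$ be integers with $R\le A N^{1/10}$, let $F$ be as above with $|a_j|,|b_j|\le N$ for all $j$, and let $(c_n)_{1\le n\le N}$ be complex numbers such that $c_n=0$ whenever $F(n)=0$ (no condition at all if $F$ has no zero in $\{1,\dots,N\}$). Then $$\Big(\sum_{m=0}^{N-1}\Big|\mathbb E_{1\le n\le N}\,c_n\,\beta_R(n)\,e(-mn/N)\Big|^p\Big)^{1/p}\le C\,\Big(\mathbb E_{1\le n\le N}|c_n|^2\beta_R(n)\Big)^{1/2}$$ and $$\Big(\int_0^1\Big|\mathbb E_{1\le n\le N}\,c_n\,\beta_R(n)\,e(n\theta)\Big|^p\,d\theta\Big)^{1/p}\le C\,N^{-1/p}\Big(\mathbb E_{1\le n\le N}|c_n|^2\beta_R(n)\Big)^{1/2}.$$ -/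

import Mathlib

namespace EnvelopingSieve

noncomputable section

/-- The additive character `e(θ) = exp(2πiθ)`. -/
def e (θ : ℝ) : ℂ := Complex.exp (2 * Real.pi * θ * Complex.I)

variable {k : ℕ}

/-- The product of `k` integer linear forms `F(n) = ∏ j, (a j * n + b j)`. -/
def F (a b : Fin k → ℤ) (n : ℤ) : ℤ := ∏ j, (a j * n + b j)

/-- The discriminant `Δ = ∏_{i < j} (a i * b j - a j * b i)`. -/
def discr (a b : Fin k → ℤ) : ℤ :=
  ∏ ij : Fin k × Fin k with ij.1 < ij.2, (a ij.1 * b ij.2 - a ij.2 * b ij.1)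

/-- The residue classes `n` modulo `q` with `(q, F(n)) = 1`, with `ℤ/qℤ` represented
by `{0, …, q - 1}`. -/
def X (a b : Fin k → ℤ) (q : ℕ) : Finset ℕ :=
  {n ∈ Finset.range q | Int.gcd (q : ℤ) (F a b (n : ℤ)) = 1}

/-- The proportion `γ(q) = |X_q| / q` of residue classes modulo `q` in `X_q`. -/
def γ (a b : Fin k → ℤ) (q : ℕ) : ℝ := ((X a b q).card : ℝ) / q

/-- The normalised Fourier coefficient `s(r/q)`, the average over `n ∈ X_q` of `e(r n / q)`. -/
def s (a b : Fin k → ℤ) (r q : ℕ) : ℂ :=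
  ((X a b q).card : ℂ)⁻¹ * ∑ n ∈ X a b q, e ((r : ℝ) * n / q)

/-- `α_R(n) = ∑_{q ≤ R} ∑_{r ∈ (ℤ/qℤ)^*} s(r/q) e(-r n / q)`. For `q = 1` the only residue is
`r = 0`. -/
def α (a b : Fin k → ℤ) (R : ℕ) (n : ℤ) : ℂ :=
  ∑ q ∈ Finset.Icc 1 R, ∑ r ∈ Finset.range q with Nat.Coprime r q,
    s a b r q * e (-((r : ℝ) * n / q))

/-- `h(q) = μ(q)² ∏_{p ∣ q} (1 - γ(p)) / γ(p)`. -/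
def h (a b : Fin k → ℤ) (q : ℕ) : ℝ :=
  (ArithmeticFunction.moebius q : ℝ) ^ 2 * ∏ p ∈ q.primeFactors, (1 - γ a b p) / γ a b p

/-- `G(R) = ∑_{q ≤ R} h(q)`. -/
def G (a b : Fin k → ℤ) (R : ℕ) : ℝ := ∑ q ∈ Finset.Icc 1 R, h a b q

/-- The enveloping sieve `β_R(n) = |α_R(n)|² / G(R)`. -/
def β (a b : Fin k → ℤ) (R : ℕ) (n : ℤ) : ℝ := (G a b R)⁻¹ * ‖α a b R n‖ ^ 2

/-- The extension operator: the average over `1 ≤ n ≤ N` of `c n * β_R(n) * e(n θ)`. -/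
def extOp (a b : Fin k → ℤ) (R N : ℕ) (c : ℕ → ℂ) (θ : ℝ) : ℂ :=
  (N : ℂ)⁻¹ * ∑ n ∈ Finset.Icc 1 N, c n * (β a b R (n : ℤ) : ℂ) * e ((n : ℝ) * θ)

/-- The weighted norm: the square root of the average over `1 ≤ n ≤ N` of `|c n|² β_R(n)`. -/
def weightedNorm (a b : Fin k → ℤ) (R N : ℕ) (c : ℕ → ℂ) : ℝ :=
  ((N : ℝ)⁻¹ * ∑ n ∈ Finset.Icc 1 N, ‖c n‖ ^ 2 * β a b R (n : ℤ)) ^ (1 / 2 : ℝ)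

end

end EnvelopingSieve

namespace EnvelopingSieve

/-! ### The additive character -/

/-! This is a restriction argument in the style of Bourgain: bounds for level sets of the extension
operator come from duality and a Fourier expansion of β_R.

Structure of the weight. Put λ_p(n) = 1_{p ∤ F(n)} / γ(p) - 1, which has mean zero modulo p. Finite
Fourier analysis and the Chinese remainder theorem turn α_R(n) into the sum over squarefree q ≤ R of
∏_{p ∣ q} λ_p(n) (`α_eq_sum`). As λ_p takes only two values, λ_p² is an affine function of λ_p.
Squaring therefore gives β_R(n) = ∑_{q ≤ R²} w(q) ∏_{p ∣ q} λ_p(n) with |w(q)| ≤ (16k)^{ω(q)};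
division by G(R) is exactly what removes R from this bound (`exists_β_eq`).

Level sets. Let V = 𝔼 |c_n|² β_R(n), and let M be a set of J frequencies m/N at which the operator
is at least t√V. Duality (`exists_sq_sum_norm_extOp_le`) gives J² t² ≤ 𝔼 β_R |g|², where g is a
trigonometric polynomial on M with coefficients of modulus at most 1. Split β_R at q = Q. The
exponential sums of the tail are O(N/√Q + R⁸), since a given θ is close to at most one fraction r/q
(`exists_norm_sum_tail_le`). The head is controlled in high moments, of every fixed order B, by a
single power of Q (`exists_sum_head_pow_le`); Hölder's inequality and Parseval for g then apply.
With Q of order t⁻⁴ the tail is absorbed and J ≪ t^{-(2 + 6/D)} remains, for any fixed D and t ≥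
N^{-1/(8(D+1))} (`exists_card_level_set_le`). Choosing D large makes the exponent smaller than p.

Conclusion. Large values are summed by the weak-type bound. Small values are handled by Parseval:
β_R(n) ≪ N^ε wherever F(n) ≠ 0, and the factor N^ε is repaid by the p - 2 spare powers of t. The
estimate on the circle is the discrete one averaged over translates of the N-th roots of unity, a
translation being a unimodular change of c. -/

theorem e_add (x y : ℝ) : e (x + y) = e x * e y := by
  simp only [e, ← Complex.exp_add]
  congr 1
  push_cast
  ring

theorem e_zero : e 0 = 1 := by simp [e]

theorem norm_e (x : ℝ) : ‖e x‖ = 1 := by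
  have : e x = Complex.exp (((2 * Real.pi * x : ℝ) : ℂ) * Complex.I) := by
    simp [e]
  rw [this, Complex.norm_exp_ofReal_mul_I]

theorem e_ne_zero (x : ℝ) : e x ≠ 0 := Complex.exp_ne_zero _

theorem e_neg_mul_e (x : ℝ) : e (-x) * e x = 1 := by
  rw [← e_add, neg_add_cancel, e_zero]

theorem conj_e (x : ℝ) : (starRingEnd ℂ) (e x) = e (-x) := by
  have h1 : (starRingEnd ℂ) (e x) * e x = 1 := by
    rw [mul_comm, Complex.mul_conj, Complex.normSq_eq_norm_sq, norm_e]; simp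
  exact mul_right_cancel₀ (e_ne_zero x) (h1.trans (e_neg_mul_e x).symm)

theorem e_natCast_mul (n : ℕ) (x : ℝ) : e (n * x) = e x ^ n := by
  simp only [e, ← Complex.exp_nat_mul]
  congr 1
  push_cast
  ring

theorem e_eq_one_iff (x : ℝ) : e x = 1 ↔ ∃ n : ℤ, x = n := by
  rw [e, Complex.exp_eq_one_iff]
  have hpi : (2 * Real.pi * Complex.I : ℂ) ≠ 0 := Complex.two_pi_I_ne_zero
  constructor
  · rintro ⟨n, hn⟩
    refine ⟨n, ?_⟩
    have : (x : ℂ) = n := by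
      apply mul_right_cancel₀ hpi
      linear_combination hn
    exact_mod_cast this
  · rintro ⟨n, rfl⟩
    exact ⟨n, by push_cast; ring⟩

theorem e_intCast (n : ℤ) : e n = 1 := (e_eq_one_iff _).2 ⟨n, rfl⟩

theorem e_natCast (n : ℕ) : e n = 1 := by exact_mod_cast e_intCast n

/-- A nontrivial root of unity of order dividing `L` has distance at least `1 / L` from `1`. -/
theorem one_le_mul_norm_one_sub {z : ℂ} {L : ℕ} (hL : z ^ L = 1) (hz : z ≠ 1) (hL0 : 0 < L)
    (hn : ‖z‖ = 1) : 1 ≤ (L : ℝ) * ‖1 - z‖ := by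
  have hpow : ∀ j : ℕ, ‖1 - z ^ j‖ ≤ j * ‖1 - z‖ := by
    intro j
    induction j with
    | zero => simp
    | succ j ih =>
      have : 1 - z ^ (j + 1) = (1 - z ^ j) + z ^ j * (1 - z) := by ring
      rw [this]
      refine (norm_add_le _ _).trans ?_
      rw [norm_mul, norm_pow, hn, one_pow]
      push_cast
      linarith
  have hsum : ∑ j ∈ Finset.range L, z ^ j = 0 := by
    have := geom_sum_mul z L
    rw [hL, sub_self] at this
    exact (mul_eq_zero.1 this).resolve_right (sub_ne_zero.2 hz)
  -- The powers of z sum to zero, so L is a sum of L terms each of size at most L ‖1 - z‖.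
  have h1 : (L : ℂ) = ∑ j ∈ Finset.range L, (1 - z ^ j) := by
    rw [Finset.sum_sub_distrib, hsum]; simp
  have h2 : (L : ℝ) ≤ L * (L * ‖1 - z‖) := by
    calc (L : ℝ) = ‖(L : ℂ)‖ := by simp
      _ ≤ ∑ j ∈ Finset.range L, ‖1 - z ^ j‖ := by rw [h1]; exact norm_sum_le _ _
      _ ≤ ∑ _j ∈ Finset.range L, (L * ‖1 - z‖) := by
        refine Finset.sum_le_sum fun j hj => (hpow j).trans ?_
        have : (j : ℝ) ≤ L := by exact_mod_cast (Finset.mem_range.1 hj).le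
        gcongr
      _ = _ := by simp
  have hL' : (0 : ℝ) < L := by exact_mod_cast hL0
  by_contra! hlt
  nlinarith

theorem norm_geom_sum_mul_le {z : ℂ} (hn : ‖z‖ = 1) (N : ℕ) :
    ‖∑ n ∈ Finset.Icc 1 N, z ^ n‖ * ‖1 - z‖ ≤ 2 := by
  have h : (∑ n ∈ Finset.Icc 1 N, z ^ n) * (1 - z) = z * (1 - z ^ N) := by
    induction N with
    | zero => simp
    | succ N ih =>
      rw [Finset.sum_Icc_succ_top (by omega), add_mul, ih]
      ring
  rw [← norm_mul, h, norm_mul, hn, one_mul]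
  refine (norm_sub_le _ _).trans ?_
  simp [hn]
  norm_num

/-! ### Sums of periodic functions -/

theorem sum_range_add_of_periodic {M : Type*} [AddCommGroup M] {f : ℕ → M} {q : ℕ}
    (hf : Function.Periodic f q) (d : ℕ) :
    ∑ n ∈ Finset.range q, f (n + d) = ∑ n ∈ Finset.range q, f n := by
  induction d with
  | zero => simp
  | succ d ih =>
    rw [← ih]
    have h1 := Finset.sum_range_succ (fun n => f (n + d)) q
    have h2 := Finset.sum_range_succ' (fun n => f (n + d)) q
    have h3 : f (q + d) = f (0 + d) := by
      rw [add_comm q d, zero_add]; exact hf d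
    rw [h1, h3] at h2
    have := add_right_cancel h2
    rw [this]
    exact Finset.sum_congr rfl fun n _ => by congr 1; ring

theorem sum_range_mul_of_periodic {f : ℕ → ℝ} {d : ℕ}
    (hf : Function.Periodic f d) (t : ℕ) :
    ∑ n ∈ Finset.range (d * t), f n = t * ∑ n ∈ Finset.range d, f n := by
  induction t with
  | zero => simp
  | succ t ih =>
    rw [mul_add, mul_one, Finset.sum_range_add, ih]
    have : ∑ x ∈ Finset.range d, f (d * t + x) = ∑ n ∈ Finset.range d, f n := by
      rw [← sum_range_add_of_periodic hf (d * t)]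
      exact Finset.sum_congr rfl fun n _ => by rw [add_comm]
    rw [this]
    push_cast
    ring

theorem sum_range_mul_of_coprime {R : Type*} [CommRing R] {f g : ℕ → R} {p m : ℕ}
    (hp : 0 < p) (hm : 0 < m) (hc : Nat.Coprime p m)
    (hf : Function.Periodic f p) (hg : Function.Periodic g m) :
    ∑ n ∈ Finset.range (p * m), f n * g n =
      (∑ n ∈ Finset.range p, f n) * ∑ n ∈ Finset.range m, g n := by
  rw [Finset.sum_mul_sum, ← Finset.sum_product']
  refine Finset.sum_bij' (fun n _ => (n % p, n % m))
    (fun x _ => (Nat.chineseRemainder hc x.1 x.2 : ℕ)) ?_ ?_ ?_ ?_ ?_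
  · intro n _
    simp [Nat.mod_lt _ hp, Nat.mod_lt _ hm]
  · intro x _
    simpa using Nat.chineseRemainder_lt_mul hc x.1 x.2 hp.ne' hm.ne'
  · intro n hn
    have hn' := Finset.mem_range.1 hn
    have := Nat.chineseRemainder_modEq_unique hc (a := n % p) (b := n % m) (z := n)
      (Nat.mod_modEq n p).symm (Nat.mod_modEq n m).symm
    exact (Nat.ModEq.eq_of_lt_of_lt this hn'
      (Nat.chineseRemainder_lt_mul hc _ _ hp.ne' hm.ne')).symm
  · rintro ⟨x, y⟩ hxy
    simp only [Finset.mem_product, Finset.mem_range] at hxy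
    have h := (Nat.chineseRemainder hc x y).2
    ext
    · exact Eq.trans h.1 (Nat.mod_eq_of_lt hxy.1)
    · exact Eq.trans h.2 (Nat.mod_eq_of_lt hxy.2)
  · intro n _
    simp only [hf.map_mod_nat, hg.map_mod_nat]

theorem periodic_prod {R ι : Type*} [CommMonoid R] {s : Finset ι} {f : ι → ℕ → R} {q : ℕ}
    (hf : ∀ i ∈ s, Function.Periodic (f i) q) :
    Function.Periodic (fun n => ∏ i ∈ s, f i n) q :=
  fun n => Finset.prod_congr rfl fun i hi => hf i hi n

theorem periodic_of_dvd {R : Type*} {f : ℕ → R} {d q : ℕ} (hf : Function.Periodic f d)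
    (h : d ∣ q) : Function.Periodic f q := by
  obtain ⟨t, rfl⟩ := h
  rw [mul_comm]
  exact hf.nat_mul t

/-- The Chinese remainder theorem for products of functions that are periodic modulo distinct
primes. -/
theorem sum_range_prod_primes {R : Type*} [CommRing R] {f : ℕ → ℕ → R} (P : Finset ℕ)
    (hP : ∀ p ∈ P, p.Prime) (hf : ∀ p ∈ P, Function.Periodic (f p) p) :
    ∑ n ∈ Finset.range (∏ p ∈ P, p), ∏ p ∈ P, f p n = ∏ p ∈ P, ∑ n ∈ Finset.range p, f p n := by
  induction P using Finset.induction_on with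
  | empty => simp
  | insert p P hp ih =>
    have hP' : ∀ x ∈ P, x.Prime := fun x hx => hP x (Finset.mem_insert_of_mem hx)
    have hf' : ∀ x ∈ P, Function.Periodic (f x) x := fun x hx => hf x (Finset.mem_insert_of_mem hx)
    have hpp := hP p (Finset.mem_insert_self _ _)
    rw [Finset.prod_insert hp, Finset.prod_insert hp, ← ih hP' hf']
    simp_rw [Finset.prod_insert hp]
    refine sum_range_mul_of_coprime hpp.pos (Finset.prod_pos fun x hx => (hP' x hx).pos) ?_
      (hf p (Finset.mem_insert_self _ _))
      (periodic_prod fun i hi => periodic_of_dvd (hf' i hi) (Finset.dvd_prod_of_mem _ hi))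
    refine Nat.Coprime.prod_right fun x hx => (Nat.coprime_primes hpp (hP' x hx)).2 ?_
    rintro rfl
    exact hp hx

theorem periodic_e (r q : ℕ) (hq : 0 < q) :
    Function.Periodic (fun n : ℕ => e ((r : ℝ) * n / q)) q := by
  intro n
  have hq' : (q : ℝ) ≠ 0 := by exact_mod_cast hq.ne'
  have : (r : ℝ) * ((n + q : ℕ) : ℝ) / q = r * n / q + r := by
    push_cast
    field_simp
  simp only [this, e_add, e_natCast, mul_one]

/-- A function of period `d` is orthogonal over `ℤ/qℤ` to the characters of `ℤ/qℤ` that do not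
have period `d`. -/
theorem sum_mul_e_eq_zero_of_periodic {f : ℕ → ℂ} {d q r : ℕ} (hq : 0 < q)
    (hf : Function.Periodic f d) (hd : d ∣ q) (hr : ¬ q ∣ r * d) :
    ∑ n ∈ Finset.range q, f n * e ((r : ℝ) * n / q) = 0 := by
  have hq' : (q : ℝ) ≠ 0 := by exact_mod_cast hq.ne'
  have hper : Function.Periodic (fun n : ℕ => f n * e ((r : ℝ) * n / q)) q := by
    intro n
    have h1 := periodic_of_dvd hf hd n
    have h2 := periodic_e r q hq n
    simp only at h1 h2 ⊢
    rw [h1, h2]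
  have h1 := sum_range_add_of_periodic hper d
  have h2 : ∀ n : ℕ, f (n + d) * e ((r : ℝ) * ((n + d : ℕ) : ℝ) / q) =
      (f n * e ((r : ℝ) * n / q)) * e ((r * d : ℕ) / q) := by
    intro n
    rw [hf n]
    have : (r : ℝ) * ((n + d : ℕ) : ℝ) / q = r * n / q + (r * d : ℕ) / q := by
      push_cast
      ring
    rw [this, e_add]
    ring
  simp_rw [h2, ← Finset.sum_mul] at h1
  have h3 : e (((r * d : ℕ) : ℝ) / q) ≠ 1 := by
    rw [Ne, e_eq_one_iff]
    rintro ⟨n, hn⟩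
    apply hr
    rw [div_eq_iff hq'] at hn
    have : ((r * d : ℕ) : ℤ) = n * q := by exact_mod_cast hn
    exact Int.natCast_dvd_natCast.1 ⟨n, by rw [this]; ring⟩
  by_contra h4
  exact h3 (mul_left_cancel₀ h4 (by rw [h1, mul_one]))

/-- The interval is covered by ⌊N/L⌋ + 1 periods, at most 2N/L of them because L ≤ N. -/
theorem sum_Icc_le_of_periodic {f : ℕ → ℝ} {L N : ℕ} (hL : 0 < L) (hN : L ≤ N)
    (hf : Function.Periodic f L) (h0 : ∀ n, 0 ≤ f n) :
    ∑ n ∈ Finset.Icc 1 N, f n ≤ 2 * N / L * ∑ n ∈ Finset.range L, f n := by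
  have hsub : Finset.Icc 1 N ⊆ Finset.range (L * (N / L + 1)) := by
    intro n hn
    rw [Finset.mem_Icc] at hn
    have := Nat.lt_mul_div_succ N hL
    exact Finset.mem_range.2 (lt_of_le_of_lt hn.2 this)
  refine (Finset.sum_le_sum_of_subset_of_nonneg hsub fun n _ _ => h0 n).trans ?_
  rw [sum_range_mul_of_periodic hf]
  refine mul_le_mul_of_nonneg_right ?_ (Finset.sum_nonneg fun n _ => h0 n)
  have hL' : (0 : ℝ) < L := by exact_mod_cast hL
  have h1 : ((N / L : ℕ) : ℝ) ≤ N / L := Nat.cast_div_le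
  have h2 : (1 : ℝ) ≤ N / L := by
    rw [le_div_iff₀ hL']; simpa using (by exact_mod_cast hN : (L : ℝ) ≤ N)
  push_cast
  rw [mul_div_assoc]
  linarith

/-! ### The number of prime factors -/

/-- Once p is large, C ≤ p^ε, so the large primes cost at most n^ε; the primes below the threshold P
cost at most C^P. -/
theorem exists_pow_card_primeFactors_le (C : ℝ) (hC : 1 ≤ C) (ε : ℝ) (hε : 0 < ε) :
    ∃ C' : ℝ, 1 ≤ C' ∧ ∀ n : ℕ, n ≠ 0 → C ^ n.primeFactors.card ≤ C' * (n : ℝ) ^ ε := by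
  obtain ⟨P, hP⟩ : ∃ P : ℕ, ∀ p : ℕ, P ≤ p → C ≤ (p : ℝ) ^ ε := by
    have := (tendsto_rpow_atTop hε).comp tendsto_natCast_atTop_atTop
    have h2 := this.eventually_ge_atTop C
    obtain ⟨P, hP⟩ := Filter.eventually_atTop.1 h2
    exact ⟨P, fun p hp => hP p hp⟩
  refine ⟨C ^ P, one_le_pow₀ hC, fun n hn => ?_⟩
  have h1 : ∀ p ∈ n.primeFactors, C ≤ (if p < P then C else 1) * (p : ℝ) ^ ε := by
    intro p hp
    have hp1 : (1 : ℝ) ≤ p := by exact_mod_cast (Nat.prime_of_mem_primeFactors hp).one_le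
    split_ifs with h
    · exact le_mul_of_one_le_right (by linarith) (Real.one_le_rpow hp1 hε.le)
    · rw [one_mul]; exact hP p (not_lt.1 h)
  calc C ^ n.primeFactors.card = ∏ _p ∈ n.primeFactors, C := by simp
    _ ≤ ∏ p ∈ n.primeFactors, ((if p < P then C else 1) * (p : ℝ) ^ ε) :=
      Finset.prod_le_prod (fun _ _ => by linarith) h1
    _ = C ^ (n.primeFactors.filter (· < P)).card * ((∏ p ∈ n.primeFactors, p : ℕ) : ℝ) ^ ε := by
      rw [Finset.prod_mul_distrib, ← Finset.prod_filter, Finset.prod_const, Nat.cast_prod,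
        Real.finsetProd_rpow _ _ (fun _ _ => by positivity)]
    _ ≤ C ^ P * (n : ℝ) ^ ε := by
      gcongr
      · calc (n.primeFactors.filter (· < P)).card ≤ (Finset.range P).card :=
              Finset.card_le_card fun p hp => by
                simpa using (Finset.mem_filter.1 hp).2
          _ = P := Finset.card_range P
      · exact Nat.le_of_dvd (Nat.pos_of_ne_zero hn) (Nat.prod_primeFactors_dvd n)

/-- Half of ε pays for the numerators and half for the logarithm from the harmonic sum. -/
theorem exists_sum_pow_card_primeFactors_div_le (C : ℝ) (hC : 1 ≤ C) (ε : ℝ) (hε : 0 < ε) :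
    ∃ C' : ℝ, 1 ≤ C' ∧ ∀ R : ℕ, 1 ≤ R →
      ∑ v ∈ Finset.Icc 1 R, C ^ v.primeFactors.card / (v : ℝ) ≤ C' * (R : ℝ) ^ ε := by
  obtain ⟨C₁, hC₁, h⟩ := exists_pow_card_primeFactors_le C hC (ε / 2) (by positivity)
  refine ⟨C₁ * (1 + 1 / (ε / 2)), ?_, fun R hR => ?_⟩
  · have : 0 < 1 / (ε / 2) := by positivity
    nlinarith
  have hR1 : (1 : ℝ) ≤ R := by exact_mod_cast hR
  have h1 : ∀ v ∈ Finset.Icc 1 R, C ^ v.primeFactors.card / (v : ℝ) ≤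
      C₁ * (R : ℝ) ^ (ε / 2) * (v : ℝ)⁻¹ := by
    intro v hv
    rw [Finset.mem_Icc] at hv
    rw [div_eq_mul_inv]
    have : (v : ℝ) ≤ R := by exact_mod_cast hv.2
    refine mul_le_mul_of_nonneg_right ((h v (by omega)).trans ?_) (by positivity)
    gcongr
  refine (Finset.sum_le_sum h1).trans ?_
  rw [← Finset.mul_sum]
  have h2 : ∑ v ∈ Finset.Icc 1 R, (v : ℝ)⁻¹ ≤ 1 + Real.log R := by
    have := harmonic_le_one_add_log R
    rw [harmonic_eq_sum_Icc] at this
    push_cast at this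
    exact this
  have h3 : Real.log R ≤ (R : ℝ) ^ (ε / 2) / (ε / 2) :=
    Real.log_le_rpow_div (by positivity) (by positivity)
  have h4 : 1 ≤ (R : ℝ) ^ (ε / 2) := Real.one_le_rpow hR1 (by positivity)
  calc C₁ * (R : ℝ) ^ (ε / 2) * ∑ v ∈ Finset.Icc 1 R, (v : ℝ)⁻¹
      ≤ C₁ * (R : ℝ) ^ (ε / 2) * ((R : ℝ) ^ (ε / 2) + (R : ℝ) ^ (ε / 2) / (ε / 2)) := by
        gcongr; linarith
    _ = C₁ * (1 + 1 / (ε / 2)) * ((R : ℝ) ^ (ε / 2) * (R : ℝ) ^ (ε / 2)) := by ring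
    _ = C₁ * (1 + 1 / (ε / 2)) * (R : ℝ) ^ ε := by
        rw [← Real.rpow_add (by linarith)]; congr 2; ring

/-! ### Local densities and the Fourier expansion of the sieve weight -/

theorem sum_range_e_mul_div {q : ℕ} (hq : 0 < q) (x : ℤ) :
    ∑ r ∈ Finset.range q, e ((r : ℝ) * (x / q)) = if (q : ℤ) ∣ x then (q : ℂ) else 0 := by
  have hq' : (q : ℝ) ≠ 0 := by exact_mod_cast hq.ne'
  simp_rw [e_natCast_mul]
  split_ifs with h
  · obtain ⟨t, rfl⟩ := h
    have : (((q : ℤ) * t : ℤ) : ℝ) / q = (t : ℤ) := by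
      push_cast; field_simp
    rw [this, e_intCast]
    simp
  · have hz : e ((x : ℝ) / q) ≠ 1 := by
      rw [Ne, e_eq_one_iff]
      rintro ⟨n, hn⟩
      rw [div_eq_iff hq'] at hn
      exact h ⟨n, by rw [mul_comm]; exact_mod_cast hn⟩
    have h1 := geom_sum_mul (e ((x : ℝ) / q)) q
    rw [← e_natCast_mul, mul_div_cancel₀ _ hq', e_intCast, sub_self] at h1
    exact (mul_eq_zero.1 h1).resolve_right (sub_ne_zero.2 hz)

theorem periodic_dvd_F {k : ℕ} (a b : Fin k → ℤ) (q n : ℕ) :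
    (q : ℤ) ∣ F a b ((n + q : ℕ) : ℤ) ↔ (q : ℤ) ∣ F a b (n : ℤ) := by
  rw [← ZMod.intCast_zmod_eq_zero_iff_dvd, ← ZMod.intCast_zmod_eq_zero_iff_dvd]
  simp [F]

theorem gcd_F_eq_one_iff {k : ℕ} (a b : Fin k → ℤ) {q : ℕ} (hq : 0 < q) (n : ℤ) :
    Int.gcd (q : ℤ) (F a b n) = 1 ↔ ∀ p ∈ q.primeFactors, ¬ (p : ℤ) ∣ F a b n := by
  rw [Int.gcd, Int.natAbs_natCast]
  constructor
  · intro h p hp hd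
    have h1 := Nat.dvd_gcd (Nat.dvd_of_mem_primeFactors hp) (Int.natCast_dvd.1 hd)
    rw [h] at h1
    exact (Nat.prime_of_mem_primeFactors hp).one_lt.ne' (Nat.dvd_one.1 h1)
  · intro h
    refine Nat.Coprime.gcd_eq_one (Nat.coprime_of_dvd fun p hp h1 h2 => ?_)
    exact h p (Nat.mem_primeFactors.2 ⟨hp, h1, hq.ne'⟩) (Int.natCast_dvd.2 h2)

section

variable {k : ℕ} (a b : Fin k → ℤ)

/-- The indicator function of `p ∤ F(n)`. -/
noncomputable def unitInd (p n : ℕ) : ℝ := if (p : ℤ) ∣ F a b (n : ℤ) then 0 else 1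

/-- The balanced local factor `1_{p ∤ F(n)} / γ(p) - 1`. -/
noncomputable def localFactor (p n : ℕ) : ℝ := unitInd a b p n / γ a b p - 1

/-- The contribution of the modulus `q` to the sieve weight `α_R(n)`. -/
noncomputable def sieveFactor (q n : ℕ) : ℝ :=
  if Squarefree q then ∏ p ∈ q.primeFactors, localFactor a b p n else 0

/-- The local weight `(1 - γ(p)) / γ(p)`. -/
noncomputable def localWeight (p : ℕ) : ℝ := (1 - γ a b p) / γ a b p

theorem periodic_unitInd (p : ℕ) : Function.Periodic (unitInd a b p) p := by
  intro n
  simp only [unitInd, periodic_dvd_F]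

theorem periodic_localFactor (p : ℕ) : Function.Periodic (localFactor a b p) p := by
  intro n
  unfold localFactor
  rw [periodic_unitInd]

theorem periodic_sieveFactor (q : ℕ) : Function.Periodic (sieveFactor a b q) q := by
  intro n
  unfold sieveFactor
  split_ifs with h
  · exact Finset.prod_congr rfl fun p hp =>
      periodic_of_dvd (periodic_localFactor a b p) (Nat.dvd_of_mem_primeFactors hp) n
  · rfl

theorem indicator_X {q : ℕ} (hq : 0 < q) (n : ℕ) :
    (if Int.gcd (q : ℤ) (F a b (n : ℤ)) = 1 then (1 : ℝ) else 0) =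
      ∏ p ∈ q.primeFactors, unitInd a b p n := by
  split_ifs with h
  · rw [gcd_F_eq_one_iff a b hq] at h
    exact (Finset.prod_eq_one fun p hp => if_neg (h p hp)).symm
  · rw [gcd_F_eq_one_iff a b hq] at h
    push Not at h
    obtain ⟨p, hp, hd⟩ := h
    exact (Finset.prod_eq_zero (f := fun p => unitInd a b p n) hp (if_pos hd)).symm

theorem card_X_eq {q : ℕ} (hq : 0 < q) :
    ((X a b q).card : ℝ) = ∑ n ∈ Finset.range q, ∏ p ∈ q.primeFactors, unitInd a b p n := by
  simp_rw [X, Finset.card_filter, ← indicator_X a b hq]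
  push_cast
  rfl

theorem sum_unitInd {p : ℕ} (hp : p.Prime) :
    ∑ n ∈ Finset.range p, unitInd a b p n = p * γ a b p := by
  have hp' : (p : ℝ) ≠ 0 := by exact_mod_cast hp.ne_zero
  rw [γ, mul_div_cancel₀ _ hp', card_X_eq a b hp.pos, hp.primeFactors]
  simp

theorem γ_eq_prod {q : ℕ} (hq : 0 < q) : γ a b q = ∏ p ∈ q.primeFactors, γ a b p := by
  have hq' : (q : ℝ) ≠ 0 := by exact_mod_cast hq.ne'
  obtain ⟨t, ht⟩ := Nat.prod_primeFactors_dvd q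
  have hpr : ∀ p ∈ q.primeFactors, p.Prime := fun p hp => Nat.prime_of_mem_primeFactors hp
  have h1 : ∑ n ∈ Finset.range q, ∏ p ∈ q.primeFactors, unitInd a b p n =
      t * ∏ p ∈ q.primeFactors, (p * γ a b p) := by
    rw [show Finset.range q = Finset.range ((∏ p ∈ q.primeFactors, p) * t) by rw [← ht],
      sum_range_mul_of_periodic, sum_range_prod_primes _ hpr
      fun p _ => periodic_unitInd a b p]
    · rw [Finset.prod_congr rfl fun p hp => sum_unitInd a b (hpr p hp)]
    · exact periodic_prod fun p hp => periodic_of_dvd (periodic_unitInd a b p)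
        (Finset.dvd_prod_of_mem _ hp)
  rw [γ, card_X_eq a b hq, h1, div_eq_iff hq', Finset.prod_mul_distrib]
  have h2 : (q : ℝ) = (∏ p ∈ q.primeFactors, (p : ℝ)) * t := by
    conv_lhs => rw [ht]
    push_cast
    rfl
  rw [h2]
  ring

variable {a b}

theorem sum_localFactor {p : ℕ} (hp : p.Prime) (hγ : 0 < γ a b p) :
    ∑ n ∈ Finset.range p, localFactor a b p n = 0 := by
  simp_rw [localFactor, Finset.sum_sub_distrib, ← Finset.sum_div]
  rw [sum_unitInd a b hp, mul_div_cancel_right₀ _ hγ.ne']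
  simp

/-- Expanding the product over subsets of the prime factors of q is summing over its squarefree
divisors. -/
theorem sum_divisors_sieveFactor {q : ℕ} (hq : 0 < q) (n : ℕ) :
    ∑ d ∈ q.divisors, sieveFactor a b d n = ∏ p ∈ q.primeFactors, (localFactor a b p n + 1) := by
  rw [Finset.prod_add_one]
  simp_rw [sieveFactor]
  rw [← Finset.sum_filter]
  refine Finset.sum_bij' (fun d _ => d.primeFactors) (fun t _ => ∏ p ∈ t, p) ?_ ?_ ?_ ?_ ?_
  · intro d hd
    rw [Finset.mem_filter, Nat.mem_divisors] at hd
    exact Finset.mem_powerset.2 (Nat.primeFactors_mono hd.1.1 hq.ne')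
  · intro t ht
    have ht := Finset.mem_powerset.1 ht
    refine Finset.mem_filter.2 ⟨Nat.mem_divisors.2 ⟨?_, hq.ne'⟩, ?_⟩
    · exact (Finset.prod_dvd_prod_of_subset _ _ _ ht).trans (Nat.prod_primeFactors_dvd q)
    · refine Finset.squarefree_prod_of_pairwise_isCoprime ?_ ?_
      · intro x hx y hy hxy
        simp only [Function.onFun]
        rw [← Nat.coprime_iff_isRelPrime]
        exact (Nat.coprime_primes (Nat.prime_of_mem_primeFactors (ht hx))
          (Nat.prime_of_mem_primeFactors (ht hy))).2 hxy
      · exact fun x hx => (Nat.prime_of_mem_primeFactors (ht hx)).squarefree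
  · intro d hd
    exact Nat.prod_primeFactors_of_squarefree (Finset.mem_filter.1 hd).2
  · intro t ht
    have ht := Finset.mem_powerset.1 ht
    exact Nat.primeFactors_prod fun p hp => Nat.prime_of_mem_primeFactors (ht hp)
  · intro d hd
    rfl

/-- The indicator of X_q is γ(q) ∏_{p ∣ q} (λ_p + 1), and the factor γ(q) cancels against |X_q| = q
γ(q). -/
theorem s_eq_sum (hγ : ∀ q : ℕ, 1 ≤ q → 0 < γ a b q) {q : ℕ} (hq : 0 < q) (r : ℕ) :
    s a b r q = (q : ℂ)⁻¹ * ∑ d ∈ q.divisors, ∑ n ∈ Finset.range q,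
      (sieveFactor a b d n : ℂ) * e ((r : ℝ) * n / q) := by
  have hq' : (q : ℝ) ≠ 0 := by exact_mod_cast hq.ne'
  have hcard : ((X a b q).card : ℝ) = q * γ a b q := by
    rw [γ, mul_div_cancel₀ _ hq']
  have h1 : ∀ n : ℕ, (if Int.gcd (q : ℤ) (F a b (n : ℤ)) = 1 then (1 : ℝ) else 0) =
      γ a b q * ∑ d ∈ q.divisors, sieveFactor a b d n := by
    intro n
    rw [sum_divisors_sieveFactor hq, indicator_X a b hq, γ_eq_prod a b hq,
      ← Finset.prod_mul_distrib]
    refine Finset.prod_congr rfl fun p hp => ?_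
    have := hγ p (Nat.prime_of_mem_primeFactors hp).one_le
    rw [localFactor, sub_add_cancel, mul_div_cancel₀ _ this.ne']
  have h2 : ∑ n ∈ X a b q, e ((r : ℝ) * n / q) = (γ a b q : ℂ) *
      ∑ n ∈ Finset.range q, ((∑ d ∈ q.divisors, sieveFactor a b d n : ℝ) : ℂ) *
        e ((r : ℝ) * n / q) := by
    rw [X, Finset.sum_filter, Finset.mul_sum]
    refine Finset.sum_congr rfl fun n _ => ?_
    rw [← mul_assoc, ← Complex.ofReal_mul, ← h1]
    split_ifs <;> simp
  have hγ' : (γ a b q : ℂ) ≠ 0 := by exact_mod_cast (hγ q hq).ne'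
  have hcard' : ((X a b q).card : ℂ) = q * γ a b q := by exact_mod_cast hcard
  rw [s, h2, hcard', mul_inv, mul_assoc, ← mul_assoc (γ a b q : ℂ)⁻¹, inv_mul_cancel₀ hγ', one_mul,
    Finset.sum_comm]
  congr 1
  refine Finset.sum_congr rfl fun n _ => ?_
  rw [Complex.ofReal_sum, Finset.sum_mul]

/-- The term of a proper divisor d has period d, hence is orthogonal to every primitive character
modulo q; only d = q survives. -/
theorem s_eq_sum_of_coprime (hγ : ∀ q : ℕ, 1 ≤ q → 0 < γ a b q) {q r : ℕ} (hq : 0 < q)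
    (hr : r.Coprime q) :
    s a b r q = (q : ℂ)⁻¹ * ∑ n ∈ Finset.range q,
      (sieveFactor a b q n : ℂ) * e ((r : ℝ) * n / q) := by
  rw [s_eq_sum hγ hq]
  congr 1
  refine Finset.sum_eq_single_of_mem q (Nat.mem_divisors_self q hq.ne') fun d hd hdq => ?_
  have hdvd := Nat.dvd_of_mem_divisors hd
  refine sum_mul_e_eq_zero_of_periodic (f := fun n => (sieveFactor a b d n : ℂ)) hq
    (fun n => ?_) hdvd fun h => hdq ?_
  · simp only [periodic_sieveFactor a b d n]
  · exact Nat.dvd_antisymm hdvd (hr.symm.dvd_of_dvd_mul_left h)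

/-- If p divides both r and q, the character depends only on n modulo q/p, so the mean-zero factor
λ_p splits off. The sum over primitive r in α_R is therefore a full Fourier inversion modulo q. -/
theorem sum_sieveFactor_mul_e_eq_zero (hγ : ∀ q : ℕ, 1 ≤ q → 0 < γ a b q) {q r : ℕ} (hq : 0 < q)
    (hr : ¬ r.Coprime q) :
    ∑ n ∈ Finset.range q, (sieveFactor a b q n : ℂ) * e ((r : ℝ) * n / q) = 0 := by
  by_cases hsq : Squarefree q
  swap
  · simp [sieveFactor, hsq]
  obtain ⟨p, hp, hpr, hpq⟩ := Nat.Prime.not_coprime_iff_dvd.1 hr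
  obtain ⟨m, rfl⟩ := hpq
  obtain ⟨r', rfl⟩ := hpr
  have hcop : p.Coprime m := Nat.coprime_of_squarefree_mul hsq
  have hm : 0 < m := Nat.pos_of_mul_pos_left hq
  have hp' : (p : ℝ) ≠ 0 := by exact_mod_cast hp.ne_zero
  have hpm : p ∉ m.primeFactors := fun h =>
    hp.one_lt.ne' (Nat.Coprime.eq_one_of_dvd hcop (Nat.dvd_of_mem_primeFactors h))
  have hpf : (p * m).primeFactors = insert p m.primeFactors := by
    rw [Nat.primeFactors_mul hp.ne_zero hm.ne', hp.primeFactors, Finset.singleton_union]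
  have h1 : ∀ n : ℕ, (sieveFactor a b (p * m) n : ℂ) * e (((p * r' : ℕ) : ℝ) * n / (p * m : ℕ)) =
      (localFactor a b p n : ℂ) * ((∏ x ∈ m.primeFactors, localFactor a b x n : ℝ) *
        e ((r' : ℝ) * n / m)) := by
    intro n
    have : ((p * r' : ℕ) : ℝ) * n / (p * m : ℕ) = (r' : ℝ) * n / m := by
      push_cast
      rw [mul_assoc, mul_div_mul_left _ _ hp']
    rw [sieveFactor, if_pos hsq, hpf, Finset.prod_insert hpm, this]
    push_cast
    ring
  simp_rw [h1]
  rw [sum_range_mul_of_coprime hp.pos hm hcop]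
  · rw [← Complex.ofReal_sum, sum_localFactor hp (hγ p hp.one_le)]
    simp
  · intro n
    simp only [periodic_localFactor a b p n]
  · intro n
    have h2 := periodic_e r' m hm n
    have h3 := periodic_prod (s := m.primeFactors) (f := localFactor a b) (q := m)
      (fun x hx => periodic_of_dvd (periodic_localFactor a b x) (Nat.dvd_of_mem_primeFactors hx)) n
    simp only at h2 h3 ⊢
    rw [h2, h3]

/-- The Fourier expansion of `sieveFactor`. -/
theorem sum_s_mul_e (hγ : ∀ q : ℕ, 1 ≤ q → 0 < γ a b q) {q : ℕ} (hq : 0 < q) (n : ℕ) :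
    ∑ r ∈ Finset.range q with Nat.Coprime r q, s a b r q * e (-((r : ℝ) * n / q)) =
      sieveFactor a b q n := by
  have hq' : (q : ℂ) ≠ 0 := by exact_mod_cast hq.ne'
  have h1 : ∑ r ∈ Finset.range q with Nat.Coprime r q, s a b r q * e (-((r : ℝ) * n / q)) =
      ∑ r ∈ Finset.range q, ((q : ℂ)⁻¹ * ∑ x ∈ Finset.range q,
        (sieveFactor a b q x : ℂ) * e ((r : ℝ) * x / q)) * e (-((r : ℝ) * n / q)) := by
    rw [Finset.sum_filter]
    refine Finset.sum_congr rfl fun r _ => ?_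
    split_ifs with h
    · rw [s_eq_sum_of_coprime hγ hq h]
    · rw [sum_sieveFactor_mul_e_eq_zero hγ hq h]
      simp
  have h2 : ∀ r x : ℕ, e ((r : ℝ) * x / q) * e (-((r : ℝ) * n / q)) =
      e ((r : ℝ) * (((x - n : ℤ) : ℝ) / q)) := by
    intro r x
    rw [← e_add]
    congr 1
    push_cast
    ring
  rw [h1]
  simp_rw [mul_assoc, Finset.sum_mul, mul_assoc, h2]
  rw [← Finset.mul_sum, Finset.sum_comm]
  simp_rw [← Finset.mul_sum, sum_range_e_mul_div hq]
  have h3 : ∀ x ∈ Finset.range q, ((sieveFactor a b q x : ℂ) *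
      if (q : ℤ) ∣ (x : ℤ) - n then (q : ℂ) else 0) =
      if x = n % q then (q : ℂ) * sieveFactor a b q n else 0 := by
    intro x hx
    have hx := Finset.mem_range.1 hx
    have hiff : (q : ℤ) ∣ (x : ℤ) - n ↔ x = n % q := by
      rw [← Nat.modEq_iff_dvd, Nat.ModEq, Nat.mod_eq_of_lt hx, eq_comm]
    by_cases h : x = n % q
    · rw [if_pos (hiff.2 h), if_pos h, h, (periodic_sieveFactor a b q).map_mod_nat, mul_comm]
    · rw [if_neg (mt hiff.1 h), if_neg h, mul_zero]
  rw [Finset.sum_congr rfl h3, Finset.sum_ite_eq', if_pos (Finset.mem_range.2 (Nat.mod_lt _ hq)),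
    inv_mul_cancel_left₀ hq']

/-- From here on α_R is a real sum of products of local factors. -/
theorem α_eq_sum (hγ : ∀ q : ℕ, 1 ≤ q → 0 < γ a b q) (R n : ℕ) :
    α a b R (n : ℤ) = ((∑ q ∈ Finset.Icc 1 R, sieveFactor a b q n : ℝ) : ℂ) := by
  rw [α, Complex.ofReal_sum]
  exact Finset.sum_congr rfl fun q hq => sum_s_mul_e hγ (Finset.mem_Icc.1 hq).1 n

end

/-! ### Bounds for local densities -/

theorem sum_le_sum_of_map_injOn {ι κ : Type*} {s : Finset ι} {t : Finset κ} {f : ι → ℝ} {g : κ → ℝ}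
    (i : ι → κ) (hi : ∀ x ∈ s, i x ∈ t) (hinj : Set.InjOn i s) (hg : ∀ y ∈ t, 0 ≤ g y)
    (hfg : ∀ x ∈ s, f x ≤ g (i x)) : ∑ x ∈ s, f x ≤ ∑ y ∈ t, g y := by
  classical
  calc ∑ x ∈ s, f x ≤ ∑ x ∈ s, g (i x) := Finset.sum_le_sum hfg
    _ = ∑ y ∈ s.image i, g y := (Finset.sum_image hinj).symm
    _ ≤ ∑ y ∈ t, g y := Finset.sum_le_sum_of_subset_of_nonneg
        (Finset.image_subset_iff.2 hi) fun y hy _ => hg y hy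

/-- A positive integer `n` has at most `2 ^ ω(n)` squarefree divisors. -/
theorem card_squarefree_dvd_le {s : Finset ℕ} {n : ℕ} (hn : n ≠ 0)
    (hs : ∀ d ∈ s, Squarefree d ∧ d ∣ n) : s.card ≤ 2 ^ n.primeFactors.card := by
  rw [← Finset.card_powerset]
  refine Finset.card_le_card_of_injOn Nat.primeFactors (fun d hd => ?_) fun d hd d' hd' h => ?_
  · exact Finset.mem_powerset.2 (Nat.primeFactors_mono (hs d hd).2 hn)
  · rw [← Nat.prod_primeFactors_of_squarefree (hs d hd).1,
      ← Nat.prod_primeFactors_of_squarefree (hs d' hd').1, h]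

section

variable {k : ℕ} {a b : Fin k → ℤ}

theorem unitInd_eq (p n : ℕ) : unitInd a b p n = 0 ∨ unitInd a b p n = 1 := by
  unfold unitInd
  split_ifs <;> simp

theorem γ_le_one {q : ℕ} : γ a b q ≤ 1 := by
  refine div_le_one_of_le₀ ?_ (by positivity)
  exact_mod_cast (Finset.card_filter_le _ _).trans (by simp)

theorem one_le_mul_γ {p : ℕ} (hγ : 0 < γ a b p) : 1 ≤ p * γ a b p := by
  have hp : (p : ℝ) ≠ 0 := by
    intro h
    simp [γ, h] at hγ
  rw [γ, mul_div_cancel₀ _ hp]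
  have : (X a b p).card ≠ 0 := by
    intro h
    simp [γ, h] at hγ
  exact_mod_cast Nat.one_le_iff_ne_zero.2 this

/-- Positivity of γ(p) prevents p from dividing both coefficients of any of the k forms, so each
form has at most one root modulo p. -/
theorem mul_one_sub_γ_le {p : ℕ} (hp : p.Prime) (hγ : 0 < γ a b p) : p * (1 - γ a b p) ≤ k := by
  have hnd : ∀ j, ¬ ((p : ℤ) ∣ a j ∧ (p : ℤ) ∣ b j) := by
    rintro j ⟨h1, h2⟩
    have h3 : ∀ n : ℕ, unitInd a b p n = 0 := by
      intro n
      refine if_pos ((dvd_add (dvd_mul_of_dvd_left h1 (n : ℤ)) h2).trans ?_)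
      exact Finset.dvd_prod_of_mem (fun j => a j * (n : ℤ) + b j) (Finset.mem_univ j)
    have h4 := sum_unitInd a b hp
    simp_rw [h3, Finset.sum_const_zero] at h4
    have : (0 : ℝ) < p * γ a b p := mul_pos (by exact_mod_cast hp.pos) hγ
    linarith
  have h1 : (p : ℝ) * (1 - γ a b p) =
      ((Finset.range p).filter fun n : ℕ => (p : ℤ) ∣ F a b (n : ℤ)).card := by
    rw [mul_sub, ← sum_unitInd a b hp, Finset.card_filter]
    push_cast
    have : (p : ℝ) * 1 = ∑ _n ∈ Finset.range p, (1 : ℝ) := by simp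
    rw [this, ← Finset.sum_sub_distrib]
    refine Finset.sum_congr rfl fun n _ => ?_
    unfold unitInd
    split_ifs <;> simp
  rw [h1]
  have h2 : ((Finset.range p).filter fun n : ℕ => (p : ℤ) ∣ F a b (n : ℤ)) ⊆
      Finset.univ.biUnion fun j : Fin k =>
        (Finset.range p).filter fun n : ℕ => (p : ℤ) ∣ a j * n + b j := by
    intro n hn
    rw [Finset.mem_filter] at hn
    obtain ⟨j, _, hj⟩ := (Prime.dvd_finsetProd_iff (Nat.prime_iff_prime_int.1 hp) _).1 hn.2
    exact Finset.mem_biUnion.2 ⟨j, Finset.mem_univ _, Finset.mem_filter.2 ⟨hn.1, hj⟩⟩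
  have h3 : ∀ j : Fin k,
      ((Finset.range p).filter fun n : ℕ => (p : ℤ) ∣ a j * n + b j).card ≤ 1 := by
    intro j
    refine Finset.card_le_one.2 fun x hx y hy => ?_
    rw [Finset.mem_filter, Finset.mem_range] at hx hy
    have hxy : (p : ℤ) ∣ a j * (x - y) := by
      have := dvd_sub hx.2 hy.2
      ring_nf at this ⊢
      exact this
    rcases (Nat.prime_iff_prime_int.1 hp).dvd_or_dvd hxy with h | h
    · exact absurd ⟨h, (dvd_add_right (dvd_mul_of_dvd_left h _)).1 hx.2⟩ (hnd j)
    · exact (Nat.ModEq.eq_of_lt_of_lt (Nat.modEq_iff_dvd.2 h) hy.1 hx.1).symm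
  have h4 := (Finset.card_le_card h2).trans (Finset.card_biUnion_le.trans
    (Finset.sum_le_sum fun j _ => h3 j))
  simp only [Finset.sum_const, Finset.card_univ, Fintype.card_fin, smul_eq_mul, mul_one] at h4
  exact_mod_cast h4

theorem localWeight_nonneg {p : ℕ} (hγ : 0 < γ a b p) : 0 ≤ localWeight a b p :=
  div_nonneg (sub_nonneg.2 γ_le_one) hγ.le

/-- For p ≤ 2k the bound γ(p) ≥ 1/p suffices; for p > 2k the count of roots gives γ(p) ≥ 1/2. -/
theorem localWeight_le (hk : 1 ≤ k) {p : ℕ} (hp : p.Prime) (hγ : 0 < γ a b p) :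
    localWeight a b p ≤ 2 * k ∧ p * localWeight a b p ≤ 4 * k ^ 2 := by
  have h1 := mul_one_sub_γ_le hp hγ
  have h2 := one_le_mul_γ hγ
  have hp0 : (1 : ℝ) ≤ p := by exact_mod_cast hp.one_le
  have hk0 : (1 : ℝ) ≤ k := by exact_mod_cast hk
  have hlw : localWeight a b p * γ a b p = 1 - γ a b p := div_mul_cancel₀ _ hγ.ne'
  have hn := localWeight_nonneg hγ
  by_cases h : (p : ℝ) ≤ 2 * k
  · have h3 : localWeight a b p ≤ 2 * k := by
      by_contra! hc
      have : 2 * k * γ a b p < 1 - γ a b p := by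
        rw [← hlw]; exact mul_lt_mul_of_pos_right hc hγ
      nlinarith
    refine ⟨h3, ?_⟩
    nlinarith
  · push Not at h
    have h4 : 1 / 2 ≤ γ a b p := by
      by_contra! hc
      nlinarith
    have h5 : p * localWeight a b p ≤ 2 * k := by
      have : p * localWeight a b p * (1 / 2) ≤ p * localWeight a b p * γ a b p := by gcongr
      rw [mul_assoc (p : ℝ) _ (γ a b p), hlw] at this
      linarith
    constructor <;> nlinarith

theorem localFactor_eq {p n : ℕ} (hγ : 0 < γ a b p) :
    localFactor a b p n =
      unitInd a b p n * localWeight a b p - (1 - unitInd a b p n) := by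
  rw [localFactor, localWeight]
  field_simp
  ring

theorem abs_localFactor {p n : ℕ} (hγ : 0 < γ a b p) :
    |localFactor a b p n| = unitInd a b p n * localWeight a b p + (1 - unitInd a b p n) := by
  rw [localFactor_eq hγ]
  rcases unitInd_eq (a := a) (b := b) p n with h | h
  · simp [h]
  · simp [h, abs_of_nonneg (localWeight_nonneg hγ)]

/-- The two values of the local factor are `localWeight` and -1, so it is a root of (x - w)(x + 1).
-/
theorem localFactor_sq {p n : ℕ} (hγ : 0 < γ a b p) :
    localFactor a b p n * localFactor a b p n =
      localWeight a b p + (localWeight a b p - 1) * localFactor a b p n := by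
  rw [localFactor_eq hγ]
  rcases unitInd_eq (a := a) (b := b) p n with h | h
  · simp [h]
  · simp only [h]; ring

theorem sum_abs_localFactor_le {p : ℕ} (hp : p.Prime) (hγ : 0 < γ a b p) :
    ∑ n ∈ Finset.range p, |localFactor a b p n| ≤ 2 * k := by
  have h1 := mul_one_sub_γ_le hp hγ
  have hlw : γ a b p * localWeight a b p = 1 - γ a b p := mul_div_cancel₀ _ hγ.ne'
  simp_rw [abs_localFactor hγ, Finset.sum_add_distrib, Finset.sum_sub_distrib, ← Finset.sum_mul,
    sum_unitInd a b hp, mul_assoc, hlw]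
  simp
  linarith

/-- The trivial bound suffices: the ℓ¹ norm of ∏ λ_p factors over primes, and each λ_p has ℓ¹ norm
2p(1 - γ(p)) ≤ 2k. -/
theorem norm_s_le (hγ : ∀ q : ℕ, 1 ≤ q → 0 < γ a b q) {q r : ℕ} (hq : 0 < q)
    (hr : r.Coprime q) : ‖s a b r q‖ ≤ (2 * k) ^ q.primeFactors.card / q := by
  rw [s_eq_sum_of_coprime hγ hq hr, norm_mul, norm_inv, Complex.norm_natCast, div_eq_inv_mul]
  refine mul_le_mul_of_nonneg_left ?_ (by positivity)
  by_cases hsq : Squarefree q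
  swap
  · simp only [sieveFactor, hsq, if_false, Complex.ofReal_zero, zero_mul, Finset.sum_const_zero,
      norm_zero]
    positivity
  have hpr : ∀ p ∈ q.primeFactors, p.Prime := fun p hp => Nat.prime_of_mem_primeFactors hp
  calc ‖∑ n ∈ Finset.range q, (sieveFactor a b q n : ℂ) * e ((r : ℝ) * n / q)‖
      ≤ ∑ n ∈ Finset.range q, ∏ p ∈ q.primeFactors, |localFactor a b p n| := by
        refine norm_sum_le_of_le _ fun n _ => ?_
        rw [norm_mul, norm_e, mul_one, Complex.norm_real, Real.norm_eq_abs, sieveFactor,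
          if_pos hsq, Finset.abs_prod]
    _ = ∏ p ∈ q.primeFactors, ∑ n ∈ Finset.range p, |localFactor a b p n| := by
        have := sum_range_prod_primes (f := fun p n => |localFactor a b p n|) q.primeFactors hpr
          fun p _ n => by simp only [periodic_localFactor a b p n]
        rwa [Nat.prod_primeFactors_of_squarefree hsq] at this
    _ ≤ ∏ _p ∈ q.primeFactors, (2 * k : ℝ) :=
        Finset.prod_le_prod (fun p _ => Finset.sum_nonneg fun n _ => abs_nonneg _)
          fun p hp => sum_abs_localFactor_le (hpr p hp) (hγ p (hpr p hp).one_le)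
    _ = _ := by simp

theorem h_eq (q : ℕ) :
    h a b q = if Squarefree q then ∏ p ∈ q.primeFactors, localWeight a b p else 0 := by
  rw [h]
  have : ((ArithmeticFunction.moebius q : ℤ) : ℝ) ^ 2 = if Squarefree q then 1 else 0 := by
    have := ArithmeticFunction.moebius_sq (n := q)
    exact_mod_cast this
  rw [this]
  split_ifs <;> simp [localWeight]

theorem h_nonneg (hγ : ∀ q : ℕ, 1 ≤ q → 0 < γ a b q) (q : ℕ) : 0 ≤ h a b q := by
  rw [h_eq]
  split_ifs
  · exact Finset.prod_nonneg fun p hp =>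
      localWeight_nonneg (hγ p (Nat.prime_of_mem_primeFactors hp).one_le)
  · exact le_rfl

theorem h_one : h a b 1 = 1 := by simp [h]

theorem one_le_G (hγ : ∀ q : ℕ, 1 ≤ q → 0 < γ a b q) {R : ℕ} (hR : 1 ≤ R) : 1 ≤ G a b R := by
  rw [← h_one (a := a) (b := b), G]
  exact Finset.single_le_sum (f := h a b) (fun q _ => h_nonneg hγ q)
    (Finset.mem_Icc.2 ⟨le_rfl, hR⟩)

theorem h_le (hk : 1 ≤ k) (hγ : ∀ q : ℕ, 1 ≤ q → 0 < γ a b q) {q : ℕ} (hq : 0 < q) :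
    h a b q ≤ (4 * k ^ 2 : ℝ) ^ q.primeFactors.card / q := by
  rw [h_eq]
  split_ifs with hsq
  · have hq' : (q : ℝ) = ∏ p ∈ q.primeFactors, (p : ℝ) := by
      rw [← Nat.cast_prod, Nat.prod_primeFactors_of_squarefree hsq]
    rw [le_div_iff₀ (by exact_mod_cast hq)]
    conv_lhs => rw [hq']
    rw [← Finset.prod_mul_distrib, ← Finset.prod_const]
    refine Finset.prod_le_prod (fun p hp => ?_) fun p hp => ?_
    · exact mul_nonneg (localWeight_nonneg (hγ p (Nat.prime_of_mem_primeFactors hp).one_le))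
        (by positivity)
    · have hpp := Nat.prime_of_mem_primeFactors hp
      rw [mul_comm]
      exact (localWeight_le hk hpp (hγ p hpp.one_le)).2
  · positivity

/-! ### Pointwise and moment bounds through the divisors of F(n) -/

variable (a b)

/-- The squarefree moduli `u ≤ Q` that divide `F(n)`. -/
def rootDivisors (Q n : ℕ) : Finset ℕ :=
  {u ∈ Finset.Icc 1 Q | Squarefree u ∧ (u : ℤ) ∣ F a b (n : ℤ)}

variable {a b}

/-- Factor q = uv, where u collects the primes dividing F(n). There |λ_p| = 1, while |λ_p| is the
local weight at the primes of v. So the term of q has size h(v), with u a root divisor and v ≤ Q. -/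
theorem sum_abs_sieveFactor_le (hγ : ∀ q : ℕ, 1 ≤ q → 0 < γ a b q) (Q n : ℕ) :
    ∑ q ∈ Finset.Icc 1 Q, |sieveFactor a b q n| ≤ (rootDivisors a b Q n).card * G a b Q := by
  have h1 : ∑ q ∈ Finset.Icc 1 Q, |sieveFactor a b q n| =
      ∑ q ∈ Finset.Icc 1 Q with Squarefree q, |sieveFactor a b q n| := by
    rw [Finset.sum_filter]
    refine Finset.sum_congr rfl fun q _ => ?_
    split_ifs with h
    · rfl
    · simp [sieveFactor, h]
  have h2 : (rootDivisors a b Q n).card * G a b Q =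
      ∑ x ∈ rootDivisors a b Q n ×ˢ Finset.Icc 1 Q, h a b x.2 := by
    rw [Finset.sum_product]
    simp [G]
  rw [h1, h2]
  have hmul : ∀ q : ℕ, Squarefree q →
      (∏ p ∈ q.primeFactors with ((p : ℕ) : ℤ) ∣ F a b (n : ℤ), p) *
        (∏ p ∈ q.primeFactors with ¬ ((p : ℕ) : ℤ) ∣ F a b (n : ℤ), p) = q := fun q hq => by
    rw [Finset.prod_filter_mul_prod_filter_not, Nat.prod_primeFactors_of_squarefree hq]
  have hIcc : ∀ q d : ℕ, q ∈ Finset.Icc 1 Q → d ∣ q → d ∈ Finset.Icc 1 Q := by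
    intro q d hq hd
    rw [Finset.mem_Icc] at hq ⊢
    exact ⟨Nat.pos_of_dvd_of_pos hd hq.1, (Nat.le_of_dvd hq.1 hd).trans hq.2⟩
  refine sum_le_sum_of_map_injOn (fun q => (∏ p ∈ q.primeFactors with ((p : ℕ) : ℤ) ∣ F a b (n : ℤ), p,
    ∏ p ∈ q.primeFactors with ¬ ((p : ℕ) : ℤ) ∣ F a b (n : ℤ), p)) ?_ ?_ (fun _ _ => h_nonneg hγ _) ?_
  · intro q hq
    rw [Finset.mem_filter] at hq
    have hm := hmul q hq.2
    have hd1 := Dvd.intro _ hm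
    have hd2 := Dvd.intro_left _ hm
    refine Finset.mem_product.2 ⟨Finset.mem_filter.2 ⟨hIcc q _ hq.1 hd1,
      hq.2.squarefree_of_dvd hd1, ?_⟩, hIcc q _ hq.1 hd2⟩
    refine Int.natCast_dvd.2 ?_
    dsimp only
    refine (Finset.prod_primes_dvd (F a b (n : ℤ)).natAbs (fun p hp => ?_) fun p hp => ?_)
    · exact (Nat.prime_of_mem_primeFactors (Finset.mem_filter.1 hp).1).prime
    · exact Int.natCast_dvd.1 (Finset.mem_filter.1 hp).2
  · intro q hq q' hq' heq
    simp only [Prod.mk.injEq] at heq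
    rw [← hmul q (Finset.mem_filter.1 hq).2, ← hmul q' (Finset.mem_filter.1 hq').2, heq.1, heq.2]
  · intro q hq
    rw [Finset.mem_filter] at hq
    have hm := hmul q hq.2
    have hd2 := Dvd.intro_left _ hm
    rw [h_eq, if_pos (hq.2.squarefree_of_dvd hd2), Nat.primeFactors_prod
      fun p hp => Nat.prime_of_mem_primeFactors (Finset.mem_filter.1 hp).1, sieveFactor,
      if_pos hq.2, Finset.abs_prod, Finset.prod_filter]
    refine (Finset.prod_congr rfl fun p hp => ?_).le
    rw [abs_localFactor (hγ p (Nat.prime_of_mem_primeFactors hp).one_le), unitInd]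
    split_ifs <;> simp

theorem exists_G_le (hk : 1 ≤ k) (ε : ℝ) (hε : 0 < ε) :
    ∃ C : ℝ, 1 ≤ C ∧ ∀ (a b : Fin k → ℤ), (∀ q : ℕ, 1 ≤ q → 0 < γ a b q) →
      ∀ R : ℕ, 1 ≤ R → G a b R ≤ C * (R : ℝ) ^ ε := by
  have hk0 : (1 : ℝ) ≤ k := by exact_mod_cast hk
  obtain ⟨C, hC, h⟩ := exists_sum_pow_card_primeFactors_div_le (4 * k ^ 2) (by nlinarith) ε hε
  refine ⟨C, hC, fun a b hγ R hR => (Finset.sum_le_sum fun q hq => ?_).trans (h R hR)⟩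
  exact h_le hk hγ (Finset.mem_Icc.1 hq).1

/-- The number of `n ≤ N` at which every prime in `P` divides `F(n)`. -/
theorem card_forall_prime_dvd_le (hγ : ∀ q : ℕ, 1 ≤ q → 0 < γ a b q) {P : Finset ℕ}
    (hP : ∀ p ∈ P, p.Prime) {N : ℕ} (hN : ∏ p ∈ P, p ≤ N) :
    (((Finset.Icc 1 N).filter fun n : ℕ => ∀ p ∈ P, (p : ℤ) ∣ F a b (n : ℤ)).card : ℝ) ≤
      2 * N * ((k : ℝ) ^ P.card / (∏ p ∈ P, p : ℕ)) := by
  have hL : 0 < ∏ p ∈ P, p := Finset.prod_pos fun p hp => (hP p hp).pos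
  have h1 : ∀ p, ∀ n, 0 ≤ 1 - unitInd a b p n := fun p n => by
    rcases unitInd_eq (a := a) (b := b) p n with h | h <;> simp [h]
  have hper : ∀ p, Function.Periodic (fun n => 1 - unitInd a b p n) p := fun p n => by
    simp only [periodic_unitInd a b p n]
  calc _ ≤ ∑ n ∈ Finset.Icc 1 N, ∏ p ∈ P, (1 - unitInd a b p n) := by
        rw [Finset.card_filter]
        push_cast
        refine Finset.sum_le_sum fun n _ => ?_
        split_ifs with h
        · refine (Finset.prod_eq_one fun p hp => ?_).ge
          rw [unitInd, if_pos (h p hp), sub_zero]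
        · exact Finset.prod_nonneg fun p _ => h1 p n
    _ ≤ 2 * N / (∏ p ∈ P, p : ℕ) * ∑ n ∈ Finset.range (∏ p ∈ P, p),
          ∏ p ∈ P, (1 - unitInd a b p n) := by
        refine sum_Icc_le_of_periodic hL hN ?_ fun n => Finset.prod_nonneg fun p _ => h1 p n
        exact periodic_prod fun p hp => periodic_of_dvd (hper p) (Finset.dvd_prod_of_mem _ hp)
    _ ≤ 2 * N / (∏ p ∈ P, p : ℕ) * ∏ _p ∈ P, (k : ℝ) := by
        rw [sum_range_prod_primes P hP fun p _ => hper p]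
        refine mul_le_mul_of_nonneg_left (Finset.prod_le_prod (fun p _ =>
          Finset.sum_nonneg fun n _ => h1 p n) fun p hp => ?_) (by positivity)
        rw [Finset.sum_sub_distrib, sum_unitInd a b (hP p hp)]
        have := mul_one_sub_γ_le (hP p hp) (hγ p (hP p hp).one_le)
        simp
        linarith
    _ = _ := by
        rw [Finset.prod_const]
        ring

/-- The B-th power counts B-tuples of moduli dividing F(n). Group the tuples by their least common
multiple l: at most 2^{Bω(l)} tuples share it, and l ∣ F(n) has density at most k^{ω(l)}/l. Since l
≤ Q^B ≤ N, counting up to N loses only a factor 2. -/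
theorem exists_sum_card_rootDivisors_pow_le (hk : 1 ≤ k) (B : ℕ) (ε : ℝ) (hε : 0 < ε) :
    ∃ C : ℝ, 1 ≤ C ∧ ∀ (a b : Fin k → ℤ), (∀ q : ℕ, 1 ≤ q → 0 < γ a b q) →
      ∀ Q N : ℕ, 1 ≤ Q → Q ^ B ≤ N →
        ∑ n ∈ Finset.Icc 1 N, ((rootDivisors a b Q n).card : ℝ) ^ B ≤ C * (Q : ℝ) ^ ε * N := by
  classical
  have hk0 : (1 : ℝ) ≤ k := by exact_mod_cast hk
  have hB1 : (0 : ℝ) < B + 1 := by positivity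
  obtain ⟨C, hC, h⟩ := exists_sum_pow_card_primeFactors_div_le (2 ^ B * k)
    (one_le_mul_of_one_le_of_one_le (one_le_pow₀ (by norm_num)) hk0) (ε / (B + 1)) (by positivity)
  refine ⟨2 * C, by linarith, fun a b hγ Q N hQ hN => ?_⟩
  have hQ1 : (1 : ℝ) ≤ Q := by exact_mod_cast hQ
  let D : Finset ℕ := {u ∈ Finset.Icc 1 Q | Squarefree u}
  let P : (Fin B → ℕ) → Finset ℕ := fun x => Finset.univ.biUnion fun i => (x i).primeFactors
  -- On squarefree tuples this is the least common multiple of the entries.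
  let L : (Fin B → ℕ) → ℕ := fun x => ∏ p ∈ P x, p
  have hPp : ∀ x, ∀ p ∈ P x, p.Prime := fun x p hp => by
    obtain ⟨i, _, hi⟩ := Finset.mem_biUnion.1 hp
    exact Nat.prime_of_mem_primeFactors hi
  have hD : ∀ x ∈ Fintype.piFinset (fun _ : Fin B => D), ∀ i,
      (1 ≤ x i ∧ x i ≤ Q) ∧ Squarefree (x i) := fun x hx i => by
    simpa [D] using Fintype.mem_piFinset.1 hx i
  have hLmem : ∀ x ∈ Fintype.piFinset (fun _ : Fin B => D), L x ∈ Finset.Icc 1 (Q ^ B) := by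
    intro x hx
    have hdvd : L x ∣ ∏ i, x i := by
      refine Finset.prod_primes_dvd _ (fun p hp => (hPp x p hp).prime) fun p hp => ?_
      obtain ⟨i, _, hi⟩ := Finset.mem_biUnion.1 hp
      exact (Nat.dvd_of_mem_primeFactors hi).trans (Finset.dvd_prod_of_mem _ (Finset.mem_univ i))
    have hpos : 0 < ∏ i, x i := Finset.prod_pos fun i _ => (hD x hx i).1.1
    refine Finset.mem_Icc.2 ⟨Nat.pos_of_dvd_of_pos hdvd hpos, (Nat.le_of_dvd hpos hdvd).trans ?_⟩
    calc ∏ i, x i ≤ ∏ _i : Fin B, Q := Finset.prod_le_prod' fun i _ => (hD x hx i).1.2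
      _ = Q ^ B := by simp
  have h1 : ∑ n ∈ Finset.Icc 1 N, ((rootDivisors a b Q n).card : ℝ) ^ B =
      ∑ x ∈ Fintype.piFinset (fun _ : Fin B => D),
        (((Finset.Icc 1 N).filter fun n : ℕ => ∀ i, (x i : ℤ) ∣ F a b (n : ℤ)).card : ℝ) := by
    have h2 : ∀ n, ((rootDivisors a b Q n).card : ℝ) ^ B =
        (((Fintype.piFinset (fun _ : Fin B => D)).filter
          fun x => ∀ i, (x i : ℤ) ∣ F a b (n : ℤ)).card : ℝ) := by
      intro n
      rw [← Nat.cast_pow]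
      have h3 := Fintype.card_piFinset_const (rootDivisors a b Q n) B
      rw [← h3]
      congr 2
      ext x
      simp only [Fintype.mem_piFinset, rootDivisors, Finset.mem_filter, D]
      exact ⟨fun h => ⟨fun i => ⟨(h i).1, (h i).2.1⟩, fun i => (h i).2.2⟩,
        fun h i => ⟨(h.1 i).1, (h.1 i).2, h.2 i⟩⟩
    simp_rw [h2]
    exact_mod_cast Finset.sum_card_bipartiteAbove_eq_sum_card_bipartiteBelow _
  have h4 : ∀ x ∈ Fintype.piFinset (fun _ : Fin B => D),
      (((Finset.Icc 1 N).filter fun n : ℕ => ∀ i, (x i : ℤ) ∣ F a b (n : ℤ)).card : ℝ) ≤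
        2 * N * ((k : ℝ) ^ (L x).primeFactors.card / L x) := by
    intro x hx
    have hLN : L x ≤ N := (Finset.mem_Icc.1 (hLmem x hx)).2.trans hN
    rw [Nat.primeFactors_prod (hPp x)]
    refine le_trans ?_ (card_forall_prime_dvd_le hγ (hPp x) hLN)
    refine Nat.cast_le.2 (Finset.card_le_card (Finset.monotone_filter_right _ fun n _ hn p hp => ?_))
    obtain ⟨i, _, hi⟩ := Finset.mem_biUnion.1 hp
    exact (Int.natCast_dvd_natCast.2 (Nat.dvd_of_mem_primeFactors hi)).trans (hn i)
  have h5 : ∀ l ∈ Finset.Icc 1 (Q ^ B),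
      (((Fintype.piFinset (fun _ : Fin B => D)).filter fun x => L x = l).card : ℝ) ≤
        (2 ^ B : ℝ) ^ l.primeFactors.card := by
    intro l hl
    have hl0 : l ≠ 0 := by rw [Finset.mem_Icc] at hl; omega
    have h6 := card_squarefree_dvd_le (s := D.filter (· ∣ l)) hl0 fun d hd => by
      simp only [D, Finset.mem_filter] at hd
      exact ⟨hd.1.2, hd.2⟩
    have h7 : (Fintype.piFinset (fun _ : Fin B => D)).filter (fun x => L x = l) ⊆
        Fintype.piFinset (fun _ : Fin B => D.filter (· ∣ l)) := by
      intro x hx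
      obtain ⟨hx, hxl⟩ := Finset.mem_filter.1 hx
      refine Fintype.mem_piFinset.2 fun i =>
        Finset.mem_filter.2 ⟨Fintype.mem_piFinset.1 hx i, ?_⟩
      have hsub : (x i).primeFactors ⊆ P x := Finset.subset_biUnion_of_mem
        (fun i => (x i).primeFactors) (Finset.mem_univ i)
      have := Finset.prod_dvd_prod_of_subset _ _ (fun p => p) hsub
      rw [Nat.prod_primeFactors_of_squarefree (hD x hx i).2] at this
      rwa [← hxl]
    have h8 := Finset.card_le_card h7
    rw [Fintype.card_piFinset_const] at h8
    have h9 := h8.trans (Nat.pow_le_pow_left h6 B)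
    rw [← pow_mul, mul_comm, pow_mul] at h9
    exact_mod_cast h9
  have hN0 : (0 : ℝ) ≤ 2 * N := by positivity
  calc ∑ n ∈ Finset.Icc 1 N, ((rootDivisors a b Q n).card : ℝ) ^ B
      ≤ ∑ x ∈ Fintype.piFinset (fun _ : Fin B => D),
          2 * N * ((k : ℝ) ^ (L x).primeFactors.card / L x) := by
        rw [h1]
        exact Finset.sum_le_sum h4
    _ = ∑ l ∈ Finset.Icc 1 (Q ^ B), ∑ x ∈ (Fintype.piFinset (fun _ : Fin B => D)) with L x = l,
          2 * N * ((k : ℝ) ^ l.primeFactors.card / l) := by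
        rw [← Finset.sum_fiberwise_of_maps_to hLmem]
        refine Finset.sum_congr rfl fun l _ => Finset.sum_congr rfl fun x hx => ?_
        rw [(Finset.mem_filter.1 hx).2]
    _ ≤ ∑ l ∈ Finset.Icc 1 (Q ^ B), 2 * N * ((2 ^ B * k : ℝ) ^ l.primeFactors.card / l) := by
        refine Finset.sum_le_sum fun l hl => ?_
        rw [Finset.sum_const, nsmul_eq_mul, mul_pow, mul_left_comm, mul_div_assoc]
        gcongr
        exact h5 l hl
    _ ≤ 2 * N * (C * ((Q ^ B : ℕ) : ℝ) ^ (ε / (B + 1))) := by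
        rw [← Finset.mul_sum]
        gcongr
        exact h _ (Nat.one_le_pow _ _ hQ)
    _ ≤ 2 * C * (Q : ℝ) ^ ε * N := by
        have : ((Q ^ B : ℕ) : ℝ) ^ (ε / (B + 1)) ≤ (Q : ℝ) ^ ε := by
          rw [Nat.cast_pow, ← Real.rpow_natCast, ← Real.rpow_mul (by positivity)]
          refine Real.rpow_le_rpow_of_exponent_le hQ1 ?_
          rw [mul_div_assoc', div_le_iff₀ hB1]
          nlinarith
        calc _ ≤ 2 * N * (C * (Q : ℝ) ^ ε) := by gcongr
          _ = _ := by ring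

end

/-! ### Expansion of the square of the sieve weight -/

theorem prod_primeFactors_add {n : ℕ} (hn : Squarefree n) (f g : ℕ → ℝ) :
    ∏ p ∈ n.primeFactors, (f p + g p) =
      ∑ x ∈ n.divisorsAntidiagonal, (∏ p ∈ x.1.primeFactors, f p) * ∏ p ∈ x.2.primeFactors, g p := by
  have h := (ArithmeticFunction.IsMultiplicative.prodPrimeFactors (R := ℝ) f)
    |>.prodPrimeFactors_add_of_squarefree
      (ArithmeticFunction.IsMultiplicative.prodPrimeFactors (R := ℝ) g) hn
  rw [ArithmeticFunction.prodPrimeFactors_apply hn.ne_zero, ArithmeticFunction.mul_apply] at h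
  have h1 : ∀ p ∈ n.primeFactors, (ArithmeticFunction.prodPrimeFactors f +
      ArithmeticFunction.prodPrimeFactors g) p = f p + g p := by
    intro p hp
    have hp := Nat.prime_of_mem_primeFactors hp
    rw [ArithmeticFunction.add_apply, ArithmeticFunction.prodPrimeFactors_apply hp.ne_zero,
      ArithmeticFunction.prodPrimeFactors_apply hp.ne_zero, hp.primeFactors]
    simp
  rw [Finset.prod_congr rfl h1] at h
  rw [h]
  refine Finset.sum_congr rfl fun x hx => ?_
  have hx := Nat.ne_zero_of_mem_divisorsAntidiagonal hx
  rw [ArithmeticFunction.prodPrimeFactors_apply hx.1,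
    ArithmeticFunction.prodPrimeFactors_apply hx.2]

section

variable {k : ℕ} {a b : Fin k → ℤ}

theorem sieveFactor_mul {m n : ℕ} (hmn : m.Coprime n) (x : ℕ) :
    sieveFactor a b (m * n) x = sieveFactor a b m x * sieveFactor a b n x := by
  have hcop : m.Coprime n ↔ True := iff_true_intro hmn
  simp only [sieveFactor, Nat.squarefree_mul_iff, hcop, true_and]
  by_cases h1 : Squarefree m <;> by_cases h2 : Squarefree n <;> simp only [h1, h2, and_self,
    and_true, and_false, if_true, if_false, mul_zero, zero_mul]
  rw [Nat.primeFactors_mul h1.ne_zero h2.ne_zero, Finset.prod_union hmn.disjoint_primeFactors]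

/-- Apply the quadratic relation for λ_p at each p ∣ g: the divisor x.1 collects the primes that
keep λ_p, and x.2 those that contribute the constant w_p. -/
theorem sieveFactor_sq (hγ : ∀ q : ℕ, 1 ≤ q → 0 < γ a b q) {g : ℕ} (hg : Squarefree g) (n : ℕ) :
    sieveFactor a b g n * sieveFactor a b g n = ∑ x ∈ g.divisorsAntidiagonal,
      (∏ p ∈ x.1.primeFactors, (localWeight a b p - 1)) * h a b x.2 * sieveFactor a b x.1 n := by
  rw [sieveFactor, if_pos hg, ← Finset.prod_mul_distrib]
  rw [Finset.prod_congr rfl fun p hp =>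
    (localFactor_sq (n := n) (hγ p (Nat.prime_of_mem_primeFactors hp).one_le)).trans
      (add_comm _ _), prod_primeFactors_add hg]
  refine Finset.sum_congr rfl fun x hx => ?_
  have hx := (Nat.mem_divisorsAntidiagonal.1 hx).1
  have h1 : Squarefree x.1 := hg.squarefree_of_dvd (Dvd.intro _ hx)
  have h2 : Squarefree x.2 := hg.squarefree_of_dvd (Dvd.intro_left _ hx)
  rw [h_eq, if_pos h2, sieveFactor, if_pos h1, Finset.prod_mul_distrib]
  ring

theorem coprime_div_gcd_of_squarefree {m n : ℕ} (hm : Squarefree m) :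
    (m / m.gcd n).Coprime (m.gcd n) :=
  Nat.coprime_of_squarefree_mul (by rwa [Nat.div_mul_cancel (Nat.gcd_dvd_left m n)])

/-- For a pair of moduli with gcd g, only the factor of g is squared. Splitting g = tm as in
`sieveFactor_sq` leaves the modulus q = (d₁/g)(d₂/g)t and the coefficient ∏_{p ∣ t} (w_p - 1) h(m).
-/
theorem exists_sq_sum_sieveFactor_eq (hk : 1 ≤ k) (hγ : ∀ q : ℕ, 1 ≤ q → 0 < γ a b q) (R : ℕ) :
    ∃ W : ℕ → ℝ, (∀ n : ℕ, (∑ q ∈ Finset.Icc 1 R, sieveFactor a b q n) ^ 2 =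
      ∑ q ∈ Finset.Icc 1 (R ^ 2), W q * sieveFactor a b q n) ∧
      ∀ q, |W q| ≤ (16 * k) ^ q.primeFactors.card * G a b R := by
  classical
  have hk0 : (1 : ℝ) ≤ k := by exact_mod_cast hk
  let D : Finset ℕ := {u ∈ Finset.Icc 1 R | Squarefree u}
  let I : Finset ((_ : ℕ × ℕ) × (ℕ × ℕ)) :=
    (D ×ˢ D).sigma fun d => (d.1.gcd d.2).divisorsAntidiagonal
  let Q : (_ : ℕ × ℕ) × (ℕ × ℕ) → ℕ := fun i =>
    (i.1.1 / i.1.1.gcd i.1.2) * (i.1.2 / i.1.1.gcd i.1.2) * i.2.1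
  let c : (_ : ℕ × ℕ) × (ℕ × ℕ) → ℝ := fun i =>
    (∏ p ∈ i.2.1.primeFactors, (localWeight a b p - 1)) * h a b i.2.2
  have hI : ∀ i ∈ I, ((1 ≤ i.1.1 ∧ i.1.1 ≤ R) ∧ Squarefree i.1.1) ∧
      ((1 ≤ i.1.2 ∧ i.1.2 ≤ R) ∧ Squarefree i.1.2) ∧ i.2.1 * i.2.2 = i.1.1.gcd i.1.2 := by
    intro i hi
    simp only [I, D, Finset.mem_sigma, Finset.mem_product, Finset.mem_filter, Finset.mem_Icc,
      Nat.mem_divisorsAntidiagonal] at hi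
    exact ⟨hi.1.1, hi.1.2, hi.2.1⟩
  have hQ : ∀ i ∈ I, Q i ∈ Finset.Icc 1 (R ^ 2) := by
    intro i hi
    obtain ⟨⟨⟨h1, h2⟩, -⟩, ⟨⟨h3, h4⟩, -⟩, h5⟩ := hI i hi
    have hg : 0 < i.1.1.gcd i.1.2 := Nat.gcd_pos_of_pos_left _ h1
    have ht : 0 < i.2.1 := by
      rw [← h5] at hg
      exact Nat.pos_of_mul_pos_right hg
    have hu1 : 0 < i.1.1 / i.1.1.gcd i.1.2 :=
      Nat.div_pos (Nat.le_of_dvd h1 (Nat.gcd_dvd_left _ _)) hg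
    have hu2 : 0 < i.1.2 / i.1.1.gcd i.1.2 :=
      Nat.div_pos (Nat.le_of_dvd h3 (Nat.gcd_dvd_right _ _)) hg
    refine Finset.mem_Icc.2 ⟨Nat.mul_pos (Nat.mul_pos hu1 hu2) ht, ?_⟩
    have h6 : i.2.1 ≤ i.1.1.gcd i.1.2 := by
      rw [← h5] at hg ⊢
      exact Nat.le_mul_of_pos_right _ (Nat.pos_of_mul_pos_left hg)
    calc Q i = (i.1.1 / i.1.1.gcd i.1.2) * ((i.1.2 / i.1.1.gcd i.1.2) * i.2.1) := mul_assoc _ _ _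
      _ ≤ i.1.1 * ((i.1.2 / i.1.1.gcd i.1.2) * i.1.1.gcd i.1.2) :=
        Nat.mul_le_mul (Nat.div_le_self _ _) (Nat.mul_le_mul_left _ h6)
      _ = i.1.1 * i.1.2 := by rw [Nat.div_mul_cancel (Nat.gcd_dvd_right _ _)]
      _ ≤ R ^ 2 := by rw [sq]; exact Nat.mul_le_mul h2 h4
  refine ⟨fun q => if Squarefree q then ∑ i ∈ I with Q i = q, c i else 0, fun n => ?_, fun q => ?_⟩
  · have h1 : ∑ q ∈ Finset.Icc 1 R, sieveFactor a b q n = ∑ q ∈ D, sieveFactor a b q n := by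
      rw [Finset.sum_filter]
      refine Finset.sum_congr rfl fun q _ => ?_
      split_ifs with hq
      · rfl
      · simp [sieveFactor, hq]
    have h2 : (∑ q ∈ D, sieveFactor a b q n) ^ 2 = ∑ i ∈ I, c i * sieveFactor a b (Q i) n := by
      rw [sq, Finset.sum_mul_sum, ← Finset.sum_product', Finset.sum_sigma]
      refine Finset.sum_congr rfl fun d hd => ?_
      simp only [D, Finset.mem_product, Finset.mem_filter] at hd
      obtain ⟨⟨-, h1⟩, -, h2⟩ := hd
      have hg : Squarefree (d.1.gcd d.2) := h1.squarefree_of_dvd (Nat.gcd_dvd_left _ _)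
      have hgpos : 0 < d.1.gcd d.2 := Nat.pos_of_ne_zero hg.ne_zero
      have hc1 := coprime_div_gcd_of_squarefree (n := d.2) h1
      have hc2 : (d.2 / d.1.gcd d.2).Coprime (d.1.gcd d.2) := by
        rw [Nat.gcd_comm]
        exact coprime_div_gcd_of_squarefree h2
      have hc3 := Nat.coprime_div_gcd_div_gcd hgpos
      have h3 : sieveFactor a b d.1 n =
          sieveFactor a b (d.1 / d.1.gcd d.2) n * sieveFactor a b (d.1.gcd d.2) n := by
        rw [← sieveFactor_mul hc1, Nat.div_mul_cancel (Nat.gcd_dvd_left _ _)]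
      have h4 : sieveFactor a b d.2 n =
          sieveFactor a b (d.2 / d.1.gcd d.2) n * sieveFactor a b (d.1.gcd d.2) n := by
        rw [← sieveFactor_mul hc2, Nat.div_mul_cancel (Nat.gcd_dvd_right _ _)]
      rw [h3, h4, mul_mul_mul_comm, sieveFactor_sq hγ hg, Finset.mul_sum]
      refine Finset.sum_congr rfl fun x hx => ?_
      have hx := Dvd.intro _ (Nat.mem_divisorsAntidiagonal.1 hx).1
      have hc4 : (d.1 / d.1.gcd d.2 * (d.2 / d.1.gcd d.2)).Coprime x.1 :=
        (Nat.Coprime.mul_left hc1 hc2).coprime_dvd_right hx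
      simp only [c, Q]
      rw [sieveFactor_mul hc4, sieveFactor_mul hc3]
      ring
    rw [h1, h2, ← Finset.sum_fiberwise_of_maps_to hQ]
    refine Finset.sum_congr rfl fun q _ => ?_
    dsimp only
    split_ifs with hq
    · rw [Finset.sum_mul]
      refine Finset.sum_congr rfl fun i hi => ?_
      rw [(Finset.mem_filter.1 hi).2]
    · rw [zero_mul]
      refine Finset.sum_eq_zero fun i hi => ?_
      rw [(Finset.mem_filter.1 hi).2, sieveFactor, if_neg hq, mul_zero]
  · have hG : 0 ≤ G a b R := Finset.sum_nonneg fun q _ => h_nonneg hγ q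
    dsimp only
    split_ifs with hq
    swap
    · rw [abs_zero]; positivity
    have hq0 := hq.ne_zero
    have hdiv := card_squarefree_dvd_le hq0 fun d (hd : d ∈ q.divisors) =>
      ⟨hq.squarefree_of_dvd (Nat.dvd_of_mem_divisors hd), Nat.dvd_of_mem_divisors hd⟩
    -- The data (d₁/g, d₂/g, t, m) determine the term, because g = tm. The first three divide q,
    -- giving 8^{ω(q)} choices; the sum of h(m) over m ≤ R is G(R); and each |w_p - 1| ≤ 2k.
    let E : Finset (((ℕ × ℕ) × ℕ) × ℕ) :=
      ((q.divisors ×ˢ q.divisors) ×ˢ q.divisors) ×ˢ Finset.Icc 1 R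
    have hmem : ∀ i ∈ I, Q i = q → i.2.1 ∣ q := fun i _ hi => by
      rw [← hi]; exact Dvd.intro_left _ rfl
    calc |∑ i ∈ I with Q i = q, c i| ≤ ∑ i ∈ I with Q i = q, |c i| := Finset.abs_sum_le_sum_abs _ _
      _ ≤ ∑ x ∈ E, (2 * k) ^ q.primeFactors.card * h a b x.2 := by
        refine sum_le_sum_of_map_injOn (fun i => (((i.1.1 / i.1.1.gcd i.1.2,
          i.1.2 / i.1.1.gcd i.1.2), i.2.1), i.2.2)) ?_ ?_ ?_ ?_
        · intro i hi
          obtain ⟨hi, hiq⟩ := Finset.mem_filter.1 hi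
          obtain ⟨⟨⟨h1, h2⟩, -⟩, -, h5⟩ := hI i hi
          have hg : 0 < i.1.1.gcd i.1.2 := Nat.gcd_pos_of_pos_left _ h1
          have hm : i.2.2 ∣ i.1.1 := (Dvd.intro_left _ h5).trans (Nat.gcd_dvd_left _ _)
          simp only [E, Finset.mem_product, Nat.mem_divisors, Finset.mem_Icc]
          refine ⟨⟨⟨⟨?_, hq0⟩, ?_, hq0⟩, hmem i hi hiq, hq0⟩, Nat.pos_of_dvd_of_pos hm h1,
            (Nat.le_of_dvd h1 hm).trans h2⟩
          · rw [← hiq]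
            exact (Dvd.intro _ rfl).trans (Dvd.intro _ rfl)
          · rw [← hiq]
            exact (Dvd.intro_left _ rfl).trans (Dvd.intro _ rfl)
        · rintro ⟨⟨d1, d2⟩, t, m⟩ hi ⟨⟨d1', d2'⟩, t', m'⟩ hi' heq
          have h1 := (hI _ (Finset.mem_filter.1 hi).1).2.2
          have h2 := (hI _ (Finset.mem_filter.1 hi').1).2.2
          simp only [Prod.mk.injEq] at heq h1 h2
          obtain ⟨⟨⟨e1, e2⟩, rfl⟩, rfl⟩ := heq
          have e3 : d1.gcd d2 = d1'.gcd d2' := h1.symm.trans h2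
          have e4 : d1 = d1' := by
            rw [← Nat.div_mul_cancel (Nat.gcd_dvd_left d1 d2), e1, e3,
              Nat.div_mul_cancel (Nat.gcd_dvd_left _ _)]
          have e5 : d2 = d2' := by
            rw [← Nat.div_mul_cancel (Nat.gcd_dvd_right d1 d2), e2, e3,
              Nat.div_mul_cancel (Nat.gcd_dvd_right _ _)]
          rw [e4, e5]
        · exact fun x _ => mul_nonneg (by positivity) (h_nonneg hγ _)
        · intro i hi
          obtain ⟨hi, hiq⟩ := Finset.mem_filter.1 hi
          simp only [c]
          rw [abs_mul, abs_of_nonneg (h_nonneg hγ i.2.2)]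
          refine mul_le_mul_of_nonneg_right ?_ (h_nonneg hγ _)
          rw [Finset.abs_prod]
          calc ∏ p ∈ i.2.1.primeFactors, |localWeight a b p - 1|
              ≤ ∏ _p ∈ i.2.1.primeFactors, (2 * k : ℝ) := by
                refine Finset.prod_le_prod (fun _ _ => abs_nonneg _) fun p hp => ?_
                have hp := Nat.prime_of_mem_primeFactors hp
                have h1 := (localWeight_le hk hp (hγ p hp.one_le)).1
                have h2 := localWeight_nonneg (hγ p hp.one_le)
                rw [abs_le]
                constructor <;> linarith
            _ = (2 * k : ℝ) ^ i.2.1.primeFactors.card := by simp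
            _ ≤ _ := pow_le_pow_right₀ (by linarith)
                (Finset.card_le_card (Nat.primeFactors_mono (hmem i hi hiq) hq0))
      _ = (q.divisors.card : ℝ) ^ 3 * ((2 * k) ^ q.primeFactors.card * G a b R) := by
        rw [Finset.sum_product]
        simp only [← Finset.mul_sum, Finset.sum_const, Finset.card_product, nsmul_eq_mul]
        rw [G]
        push_cast
        ring
      _ ≤ ((2 : ℝ) ^ q.primeFactors.card) ^ 3 * ((2 * k) ^ q.primeFactors.card * G a b R) := by
        gcongr
        exact_mod_cast hdiv
      _ = (16 * k) ^ q.primeFactors.card * G a b R := by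
        rw [← pow_mul, mul_comm _ 3, pow_mul, ← mul_assoc, ← mul_pow]
        norm_num
        left
        congr 1
        ring

/-- The Fourier-type expansion of the enveloping sieve. -/
theorem exists_β_eq (hk : 1 ≤ k) (hγ : ∀ q : ℕ, 1 ≤ q → 0 < γ a b q) {R : ℕ} (hR : 1 ≤ R) :
    ∃ w : ℕ → ℝ, (∀ n : ℕ, β a b R (n : ℤ) =
      ∑ q ∈ Finset.Icc 1 (R ^ 2), w q * sieveFactor a b q n) ∧
      ∀ q, |w q| ≤ (16 * k) ^ q.primeFactors.card := by
  obtain ⟨W, hW, hWb⟩ := exists_sq_sum_sieveFactor_eq hk hγ R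
  have hG : 0 < G a b R := zero_lt_one.trans_le (one_le_G hγ hR)
  refine ⟨fun q => (G a b R)⁻¹ * W q, fun n => ?_, fun q => ?_⟩
  · rw [β, α_eq_sum hγ, Complex.norm_real, Real.norm_eq_abs, sq_abs, hW, Finset.mul_sum]
    exact Finset.sum_congr rfl fun q _ => (mul_assoc _ _ _).symm
  · rw [abs_mul, abs_of_pos (inv_pos.2 hG), inv_mul_le_iff₀ hG, mul_comm]
    exact hWb q

theorem β_nonneg (hγ : ∀ q : ℕ, 1 ≤ q → 0 < γ a b q) (R : ℕ) (n : ℤ) : 0 ≤ β a b R n :=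
  mul_nonneg (inv_nonneg.2 (Finset.sum_nonneg fun q _ => h_nonneg hγ q)) (by positivity)

theorem β_le (hγ : ∀ q : ℕ, 1 ≤ q → 0 < γ a b q) {R : ℕ} (hR : 1 ≤ R) (n : ℕ) :
    β a b R (n : ℤ) ≤ ((rootDivisors a b R n).card : ℝ) ^ 2 * G a b R := by
  have hG : 0 < G a b R := zero_lt_one.trans_le (one_le_G hγ hR)
  rw [β, α_eq_sum hγ, Complex.norm_real, Real.norm_eq_abs, inv_mul_le_iff₀ hG]
  calc |∑ q ∈ Finset.Icc 1 R, sieveFactor a b q n| ^ 2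
      ≤ ((rootDivisors a b R n).card * G a b R) ^ 2 := by
        gcongr
        exact (Finset.abs_sum_le_sum_abs _ _).trans (sum_abs_sieveFactor_le hγ R n)
    _ = _ := by ring

end

/-! ### Major arc and minor arc bounds -/

section

variable {k : ℕ}

theorem norm_one_sub_e_sub_comm (x y : ℝ) : ‖1 - e (x - y)‖ = ‖e x - e y‖ := by
  have : e x - e y = -e y * (1 - e (x - y)) := by
    rw [show x = (x - y) + y by ring, e_add]
    ring_nf
  rw [this, norm_mul, norm_neg, norm_e, one_mul]

/-- Distinct fractions in lowest terms are separated on the circle. -/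
theorem eq_of_norm_e_sub_e_lt {q r q' r' L : ℕ} (hq : 0 < q) (hq' : 0 < q')
    (hr : r.Coprime q) (hr' : r'.Coprime q') (hrq : r < q) (hrq' : r' < q') (hL : q * q' ≤ L)
    (hlt : L * ‖e ((r : ℝ) / q) - e ((r' : ℝ) / q')‖ < 1) : q = q' ∧ r = r' := by
  have hq0 : (q : ℝ) ≠ 0 := by exact_mod_cast hq.ne'
  have hq0' : (q' : ℝ) ≠ 0 := by exact_mod_cast hq'.ne'
  rw [← norm_one_sub_e_sub_comm] at hlt
  set z := e ((r : ℝ) / q - (r' : ℝ) / q') with hz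
  -- The quotient of the two points is a root of unity of order dividing q q' ≤ L, so it is either 1
  -- or at distance at least 1/L from 1.
  have hpow : z ^ (q * q') = 1 := by
    rw [hz, ← e_natCast_mul]
    have : ((q * q' : ℕ) : ℝ) * ((r : ℝ) / q - (r' : ℝ) / q') =
        ((r * q' - r' * q : ℤ) : ℝ) := by
      push_cast
      field_simp
    rw [this, e_intCast]
  have hz1 : z = 1 := by
    by_contra hne
    have h1 := one_le_mul_norm_one_sub hpow hne (Nat.mul_pos hq hq') (norm_e _)
    have h2 : ((q * q' : ℕ) : ℝ) * ‖1 - z‖ ≤ L * ‖1 - z‖ := by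
      gcongr
    linarith
  obtain ⟨n, hn⟩ := (e_eq_one_iff _).1 hz1
  have hn' : (r * q' - r' * q : ℤ) = n * q * q' := by
    field_simp at hn
    have h3 : (r : ℝ) * q' - r' * q = n * q * q' := by linarith
    exact_mod_cast h3
  have hd1 : q ∣ q' := by
    refine hr.symm.dvd_of_dvd_mul_left (n := q') (Int.natCast_dvd_natCast.1 ?_)
    exact ⟨n * q' + r', by push_cast; linear_combination hn'⟩
  have hd2 : q' ∣ q := by
    refine hr'.symm.dvd_of_dvd_mul_left (n := q) (Int.natCast_dvd_natCast.1 ?_)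
    exact ⟨r - n * q, by push_cast; linear_combination -hn'⟩
  have hqq := Nat.dvd_antisymm hd1 hd2
  subst hqq
  refine ⟨rfl, ?_⟩
  have hqz : (q : ℤ) ≠ 0 := by exact_mod_cast hq.ne'
  have h4 : (r : ℤ) - r' = n * q := by
    apply mul_right_cancel₀ hqz
    linear_combination hn'
  refine (Nat.ModEq.eq_of_lt_of_lt (Nat.modEq_iff_dvd.2 ⟨n, ?_⟩) hrq' hrq).symm
  rw [h4, mul_comm]

/-- After Fourier expansion each fraction r/q with q > Q has a coefficient of size O(q^{-1/2}) and
multiplies a geometric sum. At most one fraction is within R⁻⁴/2 of θ and costs N/√Q; each of the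
other at most R⁴ fractions has a geometric sum of size O(R⁴). -/
theorem exists_norm_sum_tail_le (hk : 1 ≤ k) :
    ∃ C : ℝ, 1 ≤ C ∧ ∀ (a b : Fin k → ℤ), (∀ q : ℕ, 1 ≤ q → 0 < γ a b q) →
      ∀ (w : ℕ → ℝ), (∀ q, |w q| ≤ (16 * k) ^ q.primeFactors.card) →
      ∀ R Q N : ℕ, 1 ≤ Q → ∀ θ : ℝ,
        ‖∑ n ∈ Finset.Icc 1 N, ((∑ q ∈ Finset.Icc 1 (R ^ 2) with Q < q,
          w q * sieveFactor a b q n : ℝ) : ℂ) * e (n * θ)‖ ≤ C * (N / √Q + R ^ 8) := by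
  classical
  have hk0 : (1 : ℝ) ≤ k := by exact_mod_cast hk
  obtain ⟨C, hC, hω⟩ := exists_pow_card_primeFactors_le (16 * k * (2 * k)) (by nlinarith) (1 / 2)
    (by norm_num)
  refine ⟨4 * C, by linarith, fun a b hγ w hw R Q N hQ θ => ?_⟩
  have hQ0 : (0 : ℝ) < Q := by exact_mod_cast hQ
  let T : Finset ((_ : ℕ) × ℕ) := ((Finset.Icc 1 (R ^ 2)).filter fun q => Q < q).sigma
    fun q => (Finset.range q).filter fun r => Nat.Coprime r q
  let E : (_ : ℕ) × ℕ → ℂ := fun i => e (θ - (i.2 : ℝ) / i.1)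
  have hT : ∀ i ∈ T, 1 ≤ i.1 ∧ i.1 ≤ R ^ 2 ∧ Q < i.1 ∧ i.2 < i.1 ∧ i.2.Coprime i.1 := by
    intro i hi
    simp only [T, Finset.mem_sigma, Finset.mem_filter, Finset.mem_Icc, Finset.mem_range] at hi
    tauto
  have hexp : ∑ n ∈ Finset.Icc 1 N, ((∑ q ∈ Finset.Icc 1 (R ^ 2) with Q < q,
      w q * sieveFactor a b q n : ℝ) : ℂ) * e (n * θ) =
      ∑ i ∈ T, (w i.1 : ℂ) * s a b i.2 i.1 * ∑ n ∈ Finset.Icc 1 N, E i ^ n := by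
    have h1 : ∀ n : ℕ, ((∑ q ∈ Finset.Icc 1 (R ^ 2) with Q < q,
        w q * sieveFactor a b q n : ℝ) : ℂ) * e (n * θ) =
        ∑ i ∈ T, (w i.1 : ℂ) * s a b i.2 i.1 * E i ^ n := by
      intro n
      rw [Finset.sum_sigma, Complex.ofReal_sum, Finset.sum_mul]
      refine Finset.sum_congr rfl fun q hq => ?_
      have hq1 := (Finset.mem_Icc.1 (Finset.mem_filter.1 hq).1).1
      rw [Complex.ofReal_mul, ← sum_s_mul_e hγ hq1, Finset.mul_sum, Finset.sum_mul]
      refine Finset.sum_congr rfl fun r _ => ?_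
      have : E ⟨q, r⟩ ^ n = e (-((r : ℝ) * n / q)) * e (n * θ) := by
        simp only [E]
        rw [← e_natCast_mul, ← e_add]
        congr 1
        ring
      rw [this]
      ring
    simp_rw [h1, Finset.mul_sum]
    exact Finset.sum_comm
  have hcoef : ∀ i ∈ T, ‖(w i.1 : ℂ) * s a b i.2 i.1‖ ≤ C / √Q := by
    intro i hi
    obtain ⟨h1, h2, h3, h4, h5⟩ := hT i hi
    have hi0 : (0 : ℝ) < i.1 := by exact_mod_cast h1
    rw [norm_mul, Complex.norm_real, Real.norm_eq_abs]
    calc |w i.1| * ‖s a b i.2 i.1‖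
        ≤ (16 * k) ^ i.1.primeFactors.card * ((2 * k) ^ i.1.primeFactors.card / i.1) :=
          mul_le_mul (hw _) (norm_s_le hγ h1 h5) (norm_nonneg _) (by positivity)
      _ = (16 * k * (2 * k)) ^ i.1.primeFactors.card / i.1 := by rw [mul_pow (16 * (k : ℝ))]; ring
      _ ≤ C * (i.1 : ℝ) ^ (1 / 2 : ℝ) / i.1 := by
          gcongr
          exact hω _ (by omega)
      _ = C / √i.1 := by
          rw [← Real.sqrt_eq_rpow, mul_div_assoc, Real.sqrt_div_self', mul_one_div]
      _ ≤ C / √Q := by gcongr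
  -- Two near fractions would be closer than R⁻⁴, while their denominators are at most R²; hence
  -- they coincide.
  let near := T.filter fun i => 2 * (R : ℝ) ^ 4 * ‖1 - E i‖ < 1
  let far := T.filter fun i => ¬ 2 * (R : ℝ) ^ 4 * ‖1 - E i‖ < 1
  have hnear : near.card ≤ 1 := by
    refine Finset.card_le_one.2 fun i hi j hj => ?_
    simp only [near, Finset.mem_filter] at hi hj
    obtain ⟨h1, h2, h3, h4, h5⟩ := hT i hi.1
    obtain ⟨h1', h2', h3', h4', h5'⟩ := hT j hj.1
    have hdist : ‖e ((i.2 : ℝ) / i.1) - e ((j.2 : ℝ) / j.1)‖ ≤ ‖1 - E i‖ + ‖1 - E j‖ := by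
      have e1 : ‖1 - E i‖ = ‖e θ - e ((i.2 : ℝ) / i.1)‖ := norm_one_sub_e_sub_comm _ _
      have e2 : ‖1 - E j‖ = ‖e θ - e ((j.2 : ℝ) / j.1)‖ := norm_one_sub_e_sub_comm _ _
      rw [e1, e2, ← norm_neg (e θ - e ((i.2 : ℝ) / i.1))]
      refine le_trans (le_of_eq ?_) (norm_add_le _ _)
      congr 1
      ring
    have hR4 : (0 : ℝ) ≤ (R : ℝ) ^ 4 := by positivity
    obtain ⟨e1, e2⟩ := eq_of_norm_e_sub_e_lt (L := R ^ 4) h1 h1' h5 h5' h4 h4'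
      ((Nat.mul_le_mul h2 h2').trans (by ring_nf; exact le_rfl)) (by push_cast; nlinarith)
    exact Sigma.ext e1 (heq_of_eq e2)
  have hfar : (far.card : ℝ) ≤ R ^ 4 := by
    have h1 : T.card ≤ R ^ 4 := by
      rw [Finset.card_sigma]
      calc _ ≤ ∑ q ∈ (Finset.Icc 1 (R ^ 2)).filter fun q => Q < q, R ^ 2 := by
            refine Finset.sum_le_sum fun q hq => (Finset.card_filter_le _ _).trans ?_
            rw [Finset.card_range]
            exact (Finset.mem_Icc.1 (Finset.mem_filter.1 hq).1).2
        _ ≤ R ^ 2 * R ^ 2 := by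
            rw [Finset.sum_const, smul_eq_mul]
            refine Nat.mul_le_mul_right _ ((Finset.card_filter_le _ _).trans ?_)
            simp
        _ = R ^ 4 := by ring
    exact_mod_cast (Finset.card_filter_le _ _).trans h1
  have hnearterm : ∀ i ∈ near, ‖(w i.1 : ℂ) * s a b i.2 i.1 * ∑ n ∈ Finset.Icc 1 N, E i ^ n‖ ≤
      C / √Q * N := by
    intro i hi
    rw [norm_mul]
    refine mul_le_mul (hcoef i (Finset.mem_filter.1 hi).1) ?_ (norm_nonneg _) (by positivity)
    refine (norm_sum_le _ _).trans ?_
    simp [E, norm_e]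
  have hfarterm : ∀ i ∈ far, ‖(w i.1 : ℂ) * s a b i.2 i.1 * ∑ n ∈ Finset.Icc 1 N, E i ^ n‖ ≤
      C * (4 * R ^ 4) := by
    intro i hi
    simp only [far, Finset.mem_filter, not_lt] at hi
    rw [norm_mul]
    refine mul_le_mul ((hcoef i hi.1).trans ?_) ?_ (norm_nonneg _) (by positivity)
    · refine div_le_self (by linarith) ?_
      rw [Real.one_le_sqrt]
      exact_mod_cast hQ
    · have h1 := norm_geom_sum_mul_le (norm_e (θ - (i.2 : ℝ) / i.1)) N
      have h2 := hi.2
      simp only [E] at h2 ⊢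
      set D := ‖∑ n ∈ Finset.Icc 1 N, e (θ - (i.2 : ℝ) / i.1) ^ n‖
      set t := ‖1 - e (θ - (i.2 : ℝ) / i.1)‖
      calc D = D * 1 := (mul_one _).symm
        _ ≤ D * (2 * (R : ℝ) ^ 4 * t) := by gcongr
        _ = 2 * (R : ℝ) ^ 4 * (D * t) := by ring
        _ ≤ 2 * (R : ℝ) ^ 4 * 2 := by gcongr
        _ = _ := by ring
  rw [hexp, ← Finset.sum_filter_add_sum_filter_not T fun i => 2 * (R : ℝ) ^ 4 * ‖1 - E i‖ < 1]
  have hnear' : (near.card : ℝ) ≤ 1 := by exact_mod_cast hnear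
  calc _ ≤ ∑ _i ∈ near, C / √Q * N + ∑ _i ∈ far, C * (4 * (R : ℝ) ^ 4) :=
        (norm_add_le _ _).trans (add_le_add (norm_sum_le_of_le _ hnearterm)
          (norm_sum_le_of_le _ hfarterm))
    _ = near.card * (C / √Q * N) + far.card * (C * (4 * (R : ℝ) ^ 4)) := by simp
    _ ≤ 1 * (C / √Q * N) + R ^ 4 * (C * (4 * (R : ℝ) ^ 4)) := by gcongr
    _ = C * (N / √Q) + 4 * C * R ^ 8 := by ring
    _ ≤ 4 * C * (N / √Q + R ^ 8) := by
        have : 0 ≤ C * (N / √Q) := by positivity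
        linarith

/-- The point is that the power of Q does not grow with B, so its effect on the level-set exponent
vanishes as B → ∞. -/
theorem exists_sum_head_pow_le (hk : 1 ≤ k) (B : ℕ) :
    ∃ C : ℝ, 1 ≤ C ∧ ∀ (a b : Fin k → ℤ), (∀ q : ℕ, 1 ≤ q → 0 < γ a b q) →
      ∀ (w : ℕ → ℝ), (∀ q, |w q| ≤ (16 * k) ^ q.primeFactors.card) →
      ∀ R Q N : ℕ, 1 ≤ Q → Q ^ B ≤ N →
        ∑ n ∈ Finset.Icc 1 N, |∑ q ∈ Finset.Icc 1 (R ^ 2) with ¬ Q < q,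
          w q * sieveFactor a b q n| ^ B ≤ C * Q * N := by
  have hk0 : (1 : ℝ) ≤ k := by exact_mod_cast hk
  -- The weights and G(Q) each cost Q^ε, and 2εB ≤ 1/2; the moment of the divisor count costs the
  -- other Q^{1/2}.
  set ε : ℝ := 1 / (4 * (B + 1)) with hε
  have hε0 : 0 < ε := by positivity
  obtain ⟨C₁, hC₁, h₁⟩ := exists_pow_card_primeFactors_le (16 * k) (by linarith) ε hε0
  obtain ⟨C₂, hC₂, h₂⟩ := exists_G_le hk ε hε0
  obtain ⟨C₃, hC₃, h₃⟩ := exists_sum_card_rootDivisors_pow_le hk B (1 / 2) (by norm_num)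
  refine ⟨(C₁ * C₂) ^ B * C₃, one_le_mul_of_one_le_of_one_le
    (one_le_pow₀ (one_le_mul_of_one_le_of_one_le hC₁ hC₂)) hC₃, fun a b hγ w hw R Q N hQ hN => ?_⟩
  have hQ1 : (1 : ℝ) ≤ Q := by exact_mod_cast hQ
  have hpt : ∀ n : ℕ, |∑ q ∈ Finset.Icc 1 (R ^ 2) with ¬ Q < q, w q * sieveFactor a b q n| ≤
      C₁ * C₂ * ((Q : ℝ) ^ ε * (Q : ℝ) ^ ε) * (rootDivisors a b Q n).card := by
    intro n
    calc _ ≤ ∑ q ∈ Finset.Icc 1 (R ^ 2) with ¬ Q < q, |w q * sieveFactor a b q n| :=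
          Finset.abs_sum_le_sum_abs _ _
      _ ≤ ∑ q ∈ Finset.Icc 1 Q, C₁ * (Q : ℝ) ^ ε * |sieveFactor a b q n| := by
          refine sum_le_sum_of_map_injOn id ?_ (Set.injOn_id _) (fun _ _ => by positivity) ?_
          · intro q hq
            simp only [Finset.mem_filter, Finset.mem_Icc, id] at hq ⊢
            omega
          · intro q hq
            simp only [Finset.mem_filter, Finset.mem_Icc] at hq
            have hqQ : (q : ℝ) ≤ Q := by exact_mod_cast (not_lt.1 hq.2)
            rw [abs_mul, id]
            refine mul_le_mul_of_nonneg_right ?_ (abs_nonneg _)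
            refine (hw q).trans ((h₁ q (by omega)).trans ?_)
            gcongr
      _ = C₁ * (Q : ℝ) ^ ε * ∑ q ∈ Finset.Icc 1 Q, |sieveFactor a b q n| := by rw [Finset.mul_sum]
      _ ≤ C₁ * (Q : ℝ) ^ ε * ((rootDivisors a b Q n).card * (C₂ * (Q : ℝ) ^ ε)) := by
          refine mul_le_mul_of_nonneg_left ((sum_abs_sieveFactor_le hγ Q n).trans ?_)
            (by positivity)
          exact mul_le_mul_of_nonneg_left (h₂ a b hγ Q hQ) (by positivity)
      _ = _ := by ring
  have hQpow : ((Q : ℝ) ^ ε * (Q : ℝ) ^ ε) ^ B ≤ (Q : ℝ) ^ (1 / 2 : ℝ) := by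
    rw [← Real.rpow_add (by linarith), ← Real.rpow_natCast, ← Real.rpow_mul (by linarith)]
    refine Real.rpow_le_rpow_of_exponent_le hQ1 ?_
    rw [hε]
    have : (0 : ℝ) < B + 1 := by positivity
    field_simp
    linarith
  calc _ ≤ ∑ n ∈ Finset.Icc 1 N,
          (C₁ * C₂) ^ B * (Q : ℝ) ^ (1 / 2 : ℝ) * ((rootDivisors a b Q n).card : ℝ) ^ B := by
        refine Finset.sum_le_sum fun n _ => ?_
        refine (pow_le_pow_left₀ (abs_nonneg _) (hpt n) B).trans ?_
        rw [mul_pow, mul_pow (C₁ * C₂)]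
        gcongr
    _ ≤ (C₁ * C₂) ^ B * (Q : ℝ) ^ (1 / 2 : ℝ) * (C₃ * (Q : ℝ) ^ (1 / 2 : ℝ) * N) := by
        rw [← Finset.mul_sum]
        gcongr
        exact h₃ a b hγ Q N hQ hN
    _ = (C₁ * C₂) ^ B * C₃ * ((Q : ℝ) ^ (1 / 2 : ℝ) * (Q : ℝ) ^ (1 / 2 : ℝ)) * N := by ring
    _ = (C₁ * C₂) ^ B * C₃ * Q * N := by
        rw [← Real.rpow_add (by linarith)]
        norm_num

end

/-! ### Orthogonality and the quadratic form attached to the enveloping sieve -/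

/-- Parseval in a form that serves both directions: sums over points for a set of frequencies, and
sums over frequencies for functions on {1, …, N}. -/
theorem sum_norm_sq_of_orthogonal {S T : Finset ℕ} {χ : ℕ → ℕ → ℂ} {N : ℕ}
    (h : ∀ s ∈ S, ∀ s' ∈ S,
      ∑ t ∈ T, χ s t * (starRingEnd ℂ) (χ s' t) = if s = s' then (N : ℂ) else 0) (x : ℕ → ℂ) :
    ∑ t ∈ T, ‖∑ s ∈ S, x s * χ s t‖ ^ 2 = N * ∑ s ∈ S, ‖x s‖ ^ 2 := by
  have h1 : ((∑ t ∈ T, ‖∑ s ∈ S, x s * χ s t‖ ^ 2 : ℝ) : ℂ) =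
      ((N * ∑ s ∈ S, ‖x s‖ ^ 2 : ℝ) : ℂ) := by
    push_cast
    simp_rw [← Complex.mul_conj', map_sum, map_mul, Finset.sum_mul_sum]
    rw [Finset.sum_comm, Finset.mul_sum]
    refine Finset.sum_congr rfl fun s hs => ?_
    rw [Finset.sum_comm]
    have h2 : ∀ s' ∈ S, ∑ t ∈ T, x s * χ s t * ((starRingEnd ℂ) (x s') * (starRingEnd ℂ) (χ s' t)) =
        if s = s' then x s * (starRingEnd ℂ) (x s') * N else 0 := by
      intro s' hs'
      have : ∀ t, x s * χ s t * ((starRingEnd ℂ) (x s') * (starRingEnd ℂ) (χ s' t)) =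
          x s * (starRingEnd ℂ) (x s') * (χ s t * (starRingEnd ℂ) (χ s' t)) := fun t => by ring
      simp_rw [this, ← Finset.mul_sum, h s hs s' hs', mul_ite, mul_zero]
    rw [Finset.sum_congr rfl h2, Finset.sum_ite_eq, if_pos hs]
    ring
  exact_mod_cast h1

theorem sum_Icc_e_mul_div {N : ℕ} (hN : 0 < N) (x : ℤ) :
    ∑ n ∈ Finset.Icc 1 N, e ((n : ℝ) * (x / N)) = if (N : ℤ) ∣ x then (N : ℂ) else 0 := by
  have hN' : (N : ℝ) ≠ 0 := by exact_mod_cast hN.ne'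
  rw [← sum_range_e_mul_div hN]
  have hper : Function.Periodic (fun n : ℕ => e ((n : ℝ) * (x / N))) N := by
    intro n
    have : ((n + N : ℕ) : ℝ) * (x / N) = n * (x / N) + x := by
      push_cast
      field_simp
    simp only [this, e_add, e_intCast, mul_one]
  rw [← sum_range_add_of_periodic hper 1, Finset.range_eq_Ico, Finset.sum_Ico_add'
    (fun n : ℕ => e ((n : ℝ) * (x / N)))]
  congr 1

theorem sum_norm_sq_exp_sum {N : ℕ} (hN : 0 < N) {M : Finset ℕ} (hM : M ⊆ Finset.range N)
    (x : ℕ → ℂ) :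
    ∑ n ∈ Finset.Icc 1 N, ‖∑ m ∈ M, x m * e (n * -((m : ℝ) / N))‖ ^ 2 =
      N * ∑ m ∈ M, ‖x m‖ ^ 2 := by
  refine sum_norm_sq_of_orthogonal (χ := fun m n => e ((n : ℝ) * -((m : ℝ) / N)))
    (fun m hm m' hm' => ?_) x
  have h1 : ∀ n : ℕ, e ((n : ℝ) * -((m : ℝ) / N)) * (starRingEnd ℂ) (e ((n : ℝ) * -((m' : ℝ) / N))) =
      e ((n : ℝ) * (((m' - m : ℤ) : ℝ) / N)) := by
    intro n
    rw [conj_e, ← e_add]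
    congr 1
    push_cast
    ring
  simp_rw [h1, sum_Icc_e_mul_div hN]
  refine if_congr ?_ rfl rfl
  rw [← Nat.modEq_iff_dvd]
  exact ⟨fun h => Nat.ModEq.eq_of_lt_of_lt h (Finset.mem_range.1 (hM hm))
    (Finset.mem_range.1 (hM hm')), fun h => h ▸ rfl⟩

theorem sum_norm_sq_fourier {N : ℕ} (hN : 0 < N) (x : ℕ → ℂ) :
    ∑ m ∈ Finset.range N, ‖∑ n ∈ Finset.Icc 1 N, x n * e (n * -((m : ℝ) / N))‖ ^ 2 =
      N * ∑ n ∈ Finset.Icc 1 N, ‖x n‖ ^ 2 := by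
  refine sum_norm_sq_of_orthogonal (χ := fun n m => e ((n : ℝ) * -((m : ℝ) / N)))
    (fun n hn n' hn' => ?_) x
  have h1 : ∀ m : ℕ, e ((n : ℝ) * -((m : ℝ) / N)) * (starRingEnd ℂ) (e ((n' : ℝ) * -((m : ℝ) / N))) =
      e ((m : ℝ) * (((n' - n : ℤ) : ℝ) / N)) := by
    intro m
    rw [conj_e, ← e_add]
    congr 1
    push_cast
    ring
  simp_rw [h1, sum_range_e_mul_div hN]
  refine if_congr ?_ rfl rfl
  rw [Finset.mem_Icc] at hn hn'
  constructor
  · intro h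
    -- The points run over 1, …, N; shifting by one makes them the standard residues.
    have h2 : (n - 1) ≡ (n' - 1) [MOD N] := by
      rw [Nat.modEq_iff_dvd]
      convert h using 1
      omega
    have := Nat.ModEq.eq_of_lt_of_lt h2 (by omega) (by omega)
    omega
  · rintro rfl
    simp

/-- Hölder's inequality with weights, in a form without real powers. -/
theorem sum_mul_pow_le {s : Finset ℕ} {B : ℕ} (hB : 1 ≤ B) {X Y : ℕ → ℝ} (hX : ∀ i, 0 ≤ X i)
    (hY : ∀ i, 0 ≤ Y i) :
    (∑ i ∈ s, Y i * X i) ^ B ≤ (∑ i ∈ s, Y i) ^ (B - 1) * ∑ i ∈ s, Y i * X i ^ B := by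
  have hB1 : (1 : ℝ) ≤ B := by exact_mod_cast hB
  have hB0 : (B : ℝ) ≠ 0 := by positivity
  have h1 := Real.inner_le_weight_mul_Lp_of_nonneg s hB1 Y X hY hX
  have hYs : 0 ≤ ∑ i ∈ s, Y i := Finset.sum_nonneg fun i _ => hY i
  have hYX : 0 ≤ ∑ i ∈ s, Y i * X i ^ B :=
    Finset.sum_nonneg fun i _ => mul_nonneg (hY i) (pow_nonneg (hX i) _)
  simp_rw [Real.rpow_natCast] at h1
  have h2 := pow_le_pow_left₀ (Finset.sum_nonneg fun i _ => mul_nonneg (hY i) (hX i)) h1 B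
  rw [mul_pow, Real.rpow_inv_natCast_pow hYX (by omega), ← Real.rpow_mul_natCast hYs] at h2
  have h3 : (1 - (B : ℝ)⁻¹) * B = ((B - 1 : ℕ) : ℝ) := by
    rw [Nat.cast_sub hB]
    field_simp
    simp
  rwa [h3, Real.rpow_natCast] at h2

section

variable {k : ℕ}

/-- Opening |g|² turns the tail into |M|² exponential sums at the differences of frequencies. H is
the head contribution, bounded only through its B-th power so as to avoid fractional exponents. -/
theorem exists_sum_β_mul_norm_sq_le (hk : 1 ≤ k) {B : ℕ} (hB : 1 ≤ B) :
    ∃ C : ℝ, 1 ≤ C ∧ ∀ (a b : Fin k → ℤ), (∀ q : ℕ, 1 ≤ q → 0 < γ a b q) →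
      ∀ R Q N : ℕ, 1 ≤ R → 1 ≤ Q → 1 ≤ N → Q ^ B ≤ N →
      ∀ M ⊆ Finset.range N, ∀ x : ℕ → ℂ, (∀ m, ‖x m‖ ≤ 1) →
        ∃ H : ℝ, 0 ≤ H ∧ H ^ B ≤ C * Q * (M.card : ℝ) ^ (B + 1) ∧
          (N : ℝ)⁻¹ * ∑ n ∈ Finset.Icc 1 N,
            β a b R (n : ℤ) * ‖∑ m ∈ M, x m * e (n * -((m : ℝ) / N))‖ ^ 2 ≤
              C * (1 / √Q + R ^ 8 / N) * (M.card : ℝ) ^ 2 + H := by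
  obtain ⟨C₁, hC₁, h₁⟩ := exists_norm_sum_tail_le hk
  obtain ⟨C₂, hC₂, h₂⟩ := exists_sum_head_pow_le hk B
  refine ⟨max C₁ C₂, le_max_of_le_left hC₁, fun a b hγ R Q N hR hQ hN hQN M hM x hx => ?_⟩
  obtain ⟨w, hβ, hw⟩ := exists_β_eq hk hγ hR
  have hN0 : (0 : ℝ) < N := by exact_mod_cast hN
  set g : ℕ → ℂ := fun n => ∑ m ∈ M, x m * e (n * -((m : ℝ) / N)) with hg
  set head : ℕ → ℝ := fun n =>
    ∑ q ∈ Finset.Icc 1 (R ^ 2) with ¬ Q < q, w q * sieveFactor a b q n with hhead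
  set tail : ℕ → ℝ := fun n =>
    ∑ q ∈ Finset.Icc 1 (R ^ 2) with Q < q, w q * sieveFactor a b q n with htail
  have hsplit : ∀ n : ℕ, β a b R (n : ℤ) = tail n + head n := fun n => by
    rw [hβ, Finset.sum_filter_add_sum_filter_not]
  have hgJ : ∀ n, ‖g n‖ ≤ M.card := by
    intro n
    refine (norm_sum_le_of_le (n := fun _ => (1 : ℝ)) _ fun m _ => ?_).trans (by simp)
    rw [norm_mul, norm_e, mul_one]
    exact hx m
  have hgsum : ∑ n ∈ Finset.Icc 1 N, ‖g n‖ ^ 2 ≤ N * M.card := by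
    rw [hg, sum_norm_sq_exp_sum hN hM]
    gcongr
    refine (Finset.sum_le_sum (g := fun _ => (1 : ℝ)) fun m _ => ?_).trans (by simp)
    exact pow_le_one₀ (norm_nonneg _) (hx m)
  have htailbound : ∑ n ∈ Finset.Icc 1 N, tail n * ‖g n‖ ^ 2 ≤
      (M.card : ℝ) ^ 2 * (C₁ * (N / √Q + R ^ 8)) := by
    have e1 : ((∑ n ∈ Finset.Icc 1 N, tail n * ‖g n‖ ^ 2 : ℝ) : ℂ) = ∑ m ∈ M, ∑ m' ∈ M,
        x m * (starRingEnd ℂ) (x m') *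
          ∑ n ∈ Finset.Icc 1 N, (tail n : ℂ) * e (n * ((m' : ℝ) / N - (m : ℝ) / N)) := by
      push_cast
      simp_rw [← Complex.mul_conj', hg, map_sum, map_mul, Finset.sum_mul_sum, Finset.mul_sum]
      rw [Finset.sum_comm]
      refine Finset.sum_congr rfl fun m _ => ?_
      rw [Finset.sum_comm]
      refine Finset.sum_congr rfl fun m' _ => Finset.sum_congr rfl fun n _ => ?_
      have : e (n * ((m' : ℝ) / N - (m : ℝ) / N)) =
          e (n * -((m : ℝ) / N)) * e (-(n * -((m' : ℝ) / N))) := by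
        rw [← e_add]
        congr 1
        ring
      rw [this, conj_e]
      ring
    calc _ ≤ ‖((∑ n ∈ Finset.Icc 1 N, tail n * ‖g n‖ ^ 2 : ℝ) : ℂ)‖ := by
          rw [Complex.norm_real]
          exact Real.le_norm_self _
      _ ≤ ∑ _m ∈ M, ∑ _m' ∈ M, C₁ * (N / √Q + R ^ 8) := by
          rw [e1]
          refine norm_sum_le_of_le _ fun m _ => norm_sum_le_of_le _ fun m' _ => ?_
          rw [norm_mul, norm_mul, RCLike.norm_conj]
          have h3 := h₁ a b hγ w hw R Q N hQ ((m' : ℝ) / N - (m : ℝ) / N)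
          have h4 : ‖x m‖ * ‖x m'‖ ≤ 1 := mul_le_one₀ (hx m) (norm_nonneg _) (hx m')
          calc _ ≤ 1 * (C₁ * (N / √Q + R ^ 8)) :=
                mul_le_mul h4 h3 (norm_nonneg _) zero_le_one
            _ = _ := one_mul _
      _ = _ := by
          simp only [Finset.sum_const, nsmul_eq_mul]
          ring
  set H₀ : ℝ := ∑ n ∈ Finset.Icc 1 N, ‖g n‖ ^ 2 * |head n| with hH₀
  have hH₀nonneg : 0 ≤ H₀ := Finset.sum_nonneg fun n _ => by positivity
  -- Hölder with weight |g|²: Parseval bounds the total weight by N|M|, and |g| ≤ |M| inside the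
  -- moment of the head. This saves |M|^{B-1} over the trivial bound.
  have hH₀pow : H₀ ^ B ≤ (N : ℝ) ^ B * (C₂ * Q * (M.card : ℝ) ^ (B + 1)) := by
    have h3 := sum_mul_pow_le (s := Finset.Icc 1 N) hB (X := fun n => |head n|)
      (Y := fun n => ‖g n‖ ^ 2) (fun _ => abs_nonneg _) fun _ => by positivity
    obtain ⟨D, rfl⟩ : ∃ D, B = D + 1 := ⟨B - 1, by omega⟩
    rw [Nat.add_sub_cancel] at h3
    calc H₀ ^ (D + 1) ≤ (N * M.card : ℝ) ^ D *
          ∑ n ∈ Finset.Icc 1 N, (M.card : ℝ) ^ 2 * |head n| ^ (D + 1) := by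
          refine h3.trans ?_
          gcongr with n _
          exact hgJ n
      _ ≤ (N * M.card : ℝ) ^ D * ((M.card : ℝ) ^ 2 * (C₂ * Q * N)) := by
          rw [← Finset.mul_sum]
          gcongr
          exact h₂ a b hγ w hw R Q N hQ hQN
      _ = _ := by ring
  refine ⟨(N : ℝ)⁻¹ * H₀, by positivity, ?_, ?_⟩
  · rw [mul_pow, inv_pow, inv_mul_le_iff₀ (by positivity)]
    refine hH₀pow.trans ?_
    gcongr
    exact le_max_right _ _
  · have h5 : ∑ n ∈ Finset.Icc 1 N, β a b R (n : ℤ) * ‖g n‖ ^ 2 ≤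
        (M.card : ℝ) ^ 2 * (C₁ * (N / √Q + R ^ 8)) + H₀ := by
      simp_rw [hsplit, add_mul, Finset.sum_add_distrib]
      refine add_le_add htailbound (Finset.sum_le_sum fun n _ => ?_)
      rw [mul_comm]
      gcongr
      exact le_abs_self _
    calc _ ≤ (N : ℝ)⁻¹ * ((M.card : ℝ) ^ 2 * (C₁ * (N / √Q + R ^ 8)) + H₀) := by gcongr
      _ = C₁ * (1 / √Q + R ^ 8 / N) * (M.card : ℝ) ^ 2 + (N : ℝ)⁻¹ * H₀ := by
          field_simp
      _ ≤ _ := by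
          gcongr
          exact le_max_left _ _

/-- The mean value `𝔼 |c n|² β_R(n)`. -/
noncomputable def weightedMean (a b : Fin k → ℤ) (R N : ℕ) (c : ℕ → ℂ) : ℝ :=
  (N : ℝ)⁻¹ * ∑ n ∈ Finset.Icc 1 N, ‖c n‖ ^ 2 * β a b R (n : ℤ)

theorem weightedMean_nonneg {a b : Fin k → ℤ} (hγ : ∀ q : ℕ, 1 ≤ q → 0 < γ a b q) (R N : ℕ)
    (c : ℕ → ℂ) : 0 ≤ weightedMean a b R N c :=
  mul_nonneg (by positivity) (Finset.sum_nonneg fun n _ =>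
    mul_nonneg (by positivity) (β_nonneg hγ R n))

/-- Duality: the sum of the extension operator over a set of frequencies is controlled by the
quadratic form of the enveloping sieve. -/
theorem exists_sq_sum_norm_extOp_le {a b : Fin k → ℤ} (hγ : ∀ q : ℕ, 1 ≤ q → 0 < γ a b q)
    (R N : ℕ) (c : ℕ → ℂ) (M : Finset ℕ) :
    ∃ x : ℕ → ℂ, (∀ m, ‖x m‖ ≤ 1) ∧
      (∑ m ∈ M, ‖extOp a b R N c (-((m : ℝ) / N))‖) ^ 2 ≤ weightedMean a b R N c *
        ((N : ℝ)⁻¹ * ∑ n ∈ Finset.Icc 1 N,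
          β a b R (n : ℤ) * ‖∑ m ∈ M, x m * e (n * -((m : ℝ) / N))‖ ^ 2) := by
  set f : ℕ → ℂ := fun m => extOp a b R N c (-((m : ℝ) / N)) with hf
  have hβ : ∀ n : ℕ, 0 ≤ β a b R (n : ℤ) := fun n => β_nonneg hγ R n
  -- The conjugate phase of f m; it is 0 when f m = 0, since division by zero gives zero.
  refine ⟨fun m => (starRingEnd ℂ) (f m) / ‖f m‖, fun m => ?_, ?_⟩
  · rw [norm_div, RCLike.norm_conj, Complex.norm_real, norm_norm]
    exact div_self_le_one _
  have h1 : ∀ m, ((‖f m‖ : ℝ) : ℂ) = (starRingEnd ℂ) (f m) / ‖f m‖ * f m := by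
    intro m
    by_cases h0 : f m = 0
    · simp [h0]
    have : (‖f m‖ : ℂ) ≠ 0 := by simpa using h0
    rw [div_mul_eq_mul_div, Complex.conj_mul', sq, mul_div_assoc, div_self this, mul_one]
  set x : ℕ → ℂ := fun m => (starRingEnd ℂ) (f m) / ‖f m‖ with hx
  set g : ℕ → ℂ := fun n => ∑ m ∈ M, x m * e (n * -((m : ℝ) / N)) with hg
  have h1' : ∀ m, ((‖f m‖ : ℝ) : ℂ) = x m * ((N : ℂ)⁻¹ * ∑ n ∈ Finset.Icc 1 N,
      c n * (β a b R (n : ℤ) : ℂ) * e (n * -((m : ℝ) / N))) := h1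
  have h2 : ((∑ m ∈ M, ‖f m‖ : ℝ) : ℂ) =
      (N : ℂ)⁻¹ * ∑ n ∈ Finset.Icc 1 N, c n * (β a b R (n : ℤ) : ℂ) * g n := by
    rw [Complex.ofReal_sum, Finset.sum_congr rfl fun m _ => h1' m]
    simp_rw [hg, Finset.mul_sum]
    rw [Finset.sum_comm]
    refine Finset.sum_congr rfl fun n _ => Finset.sum_congr rfl fun m _ => ?_
    ring
  -- The weight is shared as √β · √β, so that Cauchy–Schwarz leaves one factor β with c and one with
  -- g.
  have h3 : ∑ m ∈ M, ‖f m‖ ≤ (N : ℝ)⁻¹ * ∑ n ∈ Finset.Icc 1 N,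
      (‖c n‖ * √(β a b R (n : ℤ))) * (√(β a b R (n : ℤ)) * ‖g n‖) := by
    calc ∑ m ∈ M, ‖f m‖ ≤ ‖((∑ m ∈ M, ‖f m‖ : ℝ) : ℂ)‖ := by
          rw [Complex.norm_real]
          exact Real.le_norm_self _
      _ ≤ _ := by
          rw [h2, norm_mul, norm_inv, Complex.norm_natCast]
          refine mul_le_mul_of_nonneg_left (norm_sum_le_of_le _ fun n _ => ?_) (by positivity)
          rw [norm_mul, norm_mul, Complex.norm_real, Real.norm_of_nonneg (hβ n)]
          refine le_of_eq ?_
          rw [mul_assoc, mul_assoc, ← mul_assoc (√_), Real.mul_self_sqrt (hβ n)]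
  calc (∑ m ∈ M, ‖f m‖) ^ 2 ≤ ((N : ℝ)⁻¹ * ∑ n ∈ Finset.Icc 1 N,
      (‖c n‖ * √(β a b R (n : ℤ))) * (√(β a b R (n : ℤ)) * ‖g n‖)) ^ 2 := by gcongr
    _ ≤ ((N : ℝ)⁻¹) ^ 2 * ((∑ n ∈ Finset.Icc 1 N, (‖c n‖ * √(β a b R (n : ℤ))) ^ 2) *
        ∑ n ∈ Finset.Icc 1 N, (√(β a b R (n : ℤ)) * ‖g n‖) ^ 2) := by
        rw [mul_pow]
        gcongr
        exact Finset.sum_mul_sq_le_sq_mul_sq _ _ _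
    _ = _ := by
        simp_rw [mul_pow, Real.sq_sqrt (hβ _), weightedMean]
        ring

end

/-! ### From level sets to the extension estimate -/

/-- A weak-type bound on a finite set implies a strong-type bound. -/
theorem sum_rpow_le_of_weak {p r K : ℝ} (hr : 0 < r) (hp : 0 < p) (hK : 0 ≤ K) {y : ℕ → ℝ}
    (M : Finset ℕ) (hy : ∀ m ∈ M, 0 ≤ y m)
    (h : ∀ m ∈ M, ((M.filter fun m' => y m ≤ y m').card : ℝ) * y m ^ r ≤ K) :
    ∑ m ∈ M, y m ^ p ≤ K ^ (p / r) * ∑ j ∈ Finset.Icc 1 M.card, (j : ℝ) ^ (-(p / r)) := by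
  -- Removing the smallest value each time, the hypothesis at the minimum of a set of j elements
  -- reads y^r ≤ K/j.
  induction M using Finset.induction_on_min_value y with
  | empty => simp
  | insert a s ha hmin ih =>
    have hys : ∀ m ∈ s, 0 ≤ y m := fun m hm => hy m (Finset.mem_insert_of_mem hm)
    have hya : 0 ≤ y a := hy a (Finset.mem_insert_self _ _)
    have ih' := ih hys fun m hm => by
      refine le_trans ?_ (h m (Finset.mem_insert_of_mem hm))
      have := hys m hm
      gcongr
      exact Finset.subset_insert _ _
    have h1 := h a (Finset.mem_insert_self _ _)
    rw [Finset.filter_true_of_mem fun m hm => by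
      rcases Finset.mem_insert.1 hm with rfl | hm
      · exact le_rfl
      · exact hmin m hm, Finset.card_insert_of_notMem ha] at h1
    rw [Finset.sum_insert ha, Finset.card_insert_of_notMem ha, Finset.sum_Icc_succ_top (by omega),
      mul_add, add_comm]
    refine add_le_add ih' ?_
    have hc : (0 : ℝ) < ((s.card + 1 : ℕ) : ℝ) := by positivity
    have h2 : y a ^ r ≤ K * ((s.card + 1 : ℕ) : ℝ)⁻¹ := by
      rw [← div_eq_mul_inv, le_div_iff₀ hc, mul_comm]
      exact h1
    calc y a ^ p = (y a ^ r) ^ (p / r) := by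
          rw [← Real.rpow_mul hya, mul_div_cancel₀ _ hr.ne']
      _ ≤ (K * ((s.card + 1 : ℕ) : ℝ)⁻¹) ^ (p / r) := by gcongr
      _ = _ := by
          rw [Real.mul_rpow hK (by positivity), Real.inv_rpow hc.le, Real.rpow_neg hc.le]

theorem exists_sum_rpow_neg_le {s : ℝ} (hs : 1 < s) :
    ∃ C : ℝ, 0 ≤ C ∧ ∀ J : ℕ, ∑ j ∈ Finset.Icc 1 J, (j : ℝ) ^ (-s) ≤ C := by
  have hsum : Summable fun j : ℕ => (j : ℝ) ^ (-s) := Real.summable_nat_rpow.2 (by linarith)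
  exact ⟨∑' j : ℕ, (j : ℝ) ^ (-s), tsum_nonneg fun _ => by positivity,
    fun J => hsum.sum_le_tsum _ fun _ _ => by positivity⟩

/-- The exponent 1/10 makes the error R⁸ of the tail smaller than N by a power of N. -/
theorem pow_eight_div_le {A : ℝ} {N R : ℕ} (hN : 1 ≤ N)
    (hR : (R : ℝ) ≤ A * (N : ℝ) ^ (1 / 10 : ℝ)) :
    (R : ℝ) ^ 8 / N ≤ A ^ 8 * (N : ℝ) ^ (-(1 / 5) : ℝ) := by
  have hN0 : (0 : ℝ) < N := by exact_mod_cast hN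
  rw [div_le_iff₀ hN0]
  calc (R : ℝ) ^ 8 ≤ (A * (N : ℝ) ^ (1 / 10 : ℝ)) ^ 8 := by gcongr
    _ = A ^ 8 * (N : ℝ) ^ (4 / 5 : ℝ) := by
        rw [mul_pow, ← Real.rpow_natCast ((N : ℝ) ^ (1 / 10 : ℝ)), ← Real.rpow_mul hN0.le]
        norm_num
    _ = A ^ 8 * ((N : ℝ) ^ (-(1 / 5) : ℝ) * (N : ℝ) ^ (1 : ℝ)) := by
        rw [← Real.rpow_add hN0]
        norm_num
    _ = _ := by rw [Real.rpow_one]; ring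

section

variable {k : ℕ}

/-- The case of a single frequency, with Q = 1 and first moments. -/
theorem exists_norm_extOp_sq_le (hk : 1 ≤ k) {A : ℝ} (hA : 0 < A) :
    ∃ U : ℝ, 1 ≤ U ∧ ∀ N R : ℕ, 1 ≤ N → 1 ≤ R → (R : ℝ) ≤ A * (N : ℝ) ^ (1 / 10 : ℝ) →
      ∀ a b : Fin k → ℤ, (∀ q : ℕ, 1 ≤ q → 0 < γ a b q) → ∀ c : ℕ → ℂ, ∀ m < N,
        ‖extOp a b R N c (-((m : ℝ) / N))‖ ^ 2 ≤ U * weightedMean a b R N c := by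
  obtain ⟨C, hC, h⟩ := exists_sum_β_mul_norm_sq_le hk (le_refl 1)
  have hA8 : 0 ≤ A ^ 8 := by positivity
  refine ⟨C * (2 + A ^ 8), one_le_mul_of_one_le_of_one_le hC (by linarith),
    fun N R hN hR hRA a b hγ c m hm => ?_⟩
  have hN1 : (1 : ℝ) ≤ N := by exact_mod_cast hN
  obtain ⟨x, hx, hdual⟩ := exists_sq_sum_norm_extOp_le hγ R N c {m}
  obtain ⟨H, hH0, hH, hX⟩ := h a b hγ R 1 N hR le_rfl hN (by simpa using hN) {m}
    (by simpa using hm) x hx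
  have hV := weightedMean_nonneg hγ R N c
  have h8 : (R : ℝ) ^ 8 / N ≤ A ^ 8 := by
    refine (pow_eight_div_le hN hRA).trans (mul_le_of_le_one_right hA8 ?_)
    exact Real.rpow_le_one_of_one_le_of_nonpos hN1 (by norm_num)
  simp only [Finset.card_singleton, Nat.cast_one, one_pow, mul_one, pow_one, Real.sqrt_one,
    div_one] at hH hX
  rw [Finset.sum_singleton] at hdual
  refine hdual.trans ?_
  rw [mul_comm]
  refine mul_le_mul_of_nonneg_right (hX.trans ?_) hV
  nlinarith

/-- With B = D + 1 and the tail absorbed, (J²t²/2)^{D+1} ≪ Q J^{D+2} with Q of order t⁻⁴; dividing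
by J^{D+2} gives the exponent 2(D+1) + 4 of t. -/
theorem exists_card_level_set_le (hk : 1 ≤ k) {A : ℝ} {D : ℕ} (hD : 1 ≤ D) :
    ∃ (K : ℝ) (N₀ : ℕ), 1 ≤ K ∧ ∀ N R : ℕ, 1 ≤ N → N₀ ≤ N → 1 ≤ R →
      (R : ℝ) ≤ A * (N : ℝ) ^ (1 / 10 : ℝ) →
      ∀ a b : Fin k → ℤ, (∀ q : ℕ, 1 ≤ q → 0 < γ a b q) →
      ∀ c : ℕ → ℂ, 0 < weightedMean a b R N c →
      ∀ t : ℝ, 0 < t → t ≤ 1 → (N : ℝ) ^ (-(1 / (8 * (D + 1))) : ℝ) ≤ t →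
      ∀ M ⊆ Finset.range N,
        (∀ m ∈ M, t * √(weightedMean a b R N c) ≤ ‖extOp a b R N c (-((m : ℝ) / N))‖) →
        (M.card : ℝ) ^ D * t ^ (2 * D + 6) ≤ K := by
  obtain ⟨C, hC, h⟩ := exists_sum_β_mul_norm_sq_le hk (show 1 ≤ D + 1 by omega)
  have hev1 : ∀ᶠ N : ℕ in Filter.atTop, 4 * C * A ^ 8 ≤ (N : ℝ) ^ (3 / 40 : ℝ) :=
    ((tendsto_rpow_atTop (by norm_num : (0 : ℝ) < 3 / 40)).comp
      tendsto_natCast_atTop_atTop).eventually_ge_atTop _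
  have hev2 : ∀ᶠ N : ℕ in Filter.atTop, (17 * C ^ 2) ^ (D + 1) ≤ (N : ℝ) ^ (1 / 2 : ℝ) :=
    ((tendsto_rpow_atTop (by norm_num : (0 : ℝ) < 1 / 2)).comp
      tendsto_natCast_atTop_atTop).eventually_ge_atTop _
  obtain ⟨N₀, hN₀⟩ := Filter.eventually_atTop.1 (hev1.and hev2)
  refine ⟨2 ^ (D + 1) * (17 * C ^ 3), N₀, ?_, ?_⟩
  · refine one_le_mul_of_one_le_of_one_le (one_le_pow₀ (by norm_num)) ?_
    have : 1 ≤ C ^ 3 := one_le_pow₀ hC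
    linarith
  intro N R hN hNN₀ hR hRA a b hγ c hV t ht ht1 htN M hM hlev
  obtain ⟨hN1, hN2⟩ := hN₀ N hNN₀
  have hC0 : 0 < C := by linarith
  have hNr : (1 : ℝ) ≤ N := by exact_mod_cast hN
  have hNpos : (0 : ℝ) < N := by linarith
  rcases M.eq_empty_or_nonempty with rfl | hMne
  · simp only [Finset.card_empty, Nat.cast_zero, zero_pow (by omega : D ≠ 0), zero_mul]
    positivity
  have hJ : (0 : ℝ) < M.card := by exact_mod_cast hMne.card_pos
  set J : ℝ := (M.card : ℝ) with hJdef
  -- The least Q with C/√Q ≤ t²/4. The lower bound on t and N ≥ N₀ ensure Q^{D+1} ≤ N, as the head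
  -- moments require.
  set Q : ℕ := ⌈16 * C ^ 2 / t ^ 4⌉₊ with hQdef
  have ht4 : t ^ 4 ≤ 1 := pow_le_one₀ ht.le ht1
  have hC2 : 1 ≤ C ^ 2 := one_le_pow₀ hC
  have hbig : 1 ≤ C ^ 2 / t ^ 4 := by
    rw [le_div_iff₀ (by positivity)]
    linarith
  have hQge : 16 * C ^ 2 / t ^ 4 ≤ Q := Nat.le_ceil _
  have hQle : (Q : ℝ) ≤ 17 * C ^ 2 / t ^ 4 := by
    have h1 := (Nat.ceil_lt_add_one (show 0 ≤ 16 * C ^ 2 / t ^ 4 by positivity)).le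
    have h2 : 17 * C ^ 2 / t ^ 4 = 16 * C ^ 2 / t ^ 4 + C ^ 2 / t ^ 4 := by ring
    rw [h2]
    linarith
  have hQ1 : 1 ≤ Q := Nat.one_le_iff_ne_zero.2 (Nat.ceil_pos.2 (by positivity)).ne'
  have hQB : Q ^ (D + 1) ≤ N := by
    have h1 : 1 ≤ t ^ (4 * (D + 1)) * (N : ℝ) ^ (1 / 2 : ℝ) := by
      have h2 : (N : ℝ) ^ (-(1 / 2) : ℝ) ≤ t ^ (4 * (D + 1)) := by
        calc (N : ℝ) ^ (-(1 / 2) : ℝ) =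
            ((N : ℝ) ^ (-(1 / (8 * (D + 1))) : ℝ)) ^ (4 * (D + 1)) := by
              rw [← Real.rpow_natCast, ← Real.rpow_mul hNpos.le]
              congr 1
              push_cast
              field_simp
              norm_num
          _ ≤ _ := by gcongr
      calc (1 : ℝ) = (N : ℝ) ^ (-(1 / 2) : ℝ) * (N : ℝ) ^ (1 / 2 : ℝ) := by
            rw [← Real.rpow_add hNpos]
            norm_num
        _ ≤ _ := by gcongr
    have h3 : (Q : ℝ) ^ (D + 1) ≤ N := by
      calc (Q : ℝ) ^ (D + 1) ≤ (17 * C ^ 2 / t ^ 4) ^ (D + 1) := by gcongr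
        _ = (17 * C ^ 2) ^ (D + 1) / t ^ (4 * (D + 1)) := by rw [div_pow, ← pow_mul]
        _ ≤ (N : ℝ) ^ (1 / 2 : ℝ) * (N : ℝ) ^ (1 / 2 : ℝ) := by
            rw [div_le_iff₀ (by positivity)]
            calc (17 * C ^ 2) ^ (D + 1) ≤ (N : ℝ) ^ (1 / 2 : ℝ) * 1 := by rw [mul_one]; exact hN2
              _ ≤ (N : ℝ) ^ (1 / 2 : ℝ) * (t ^ (4 * (D + 1)) * (N : ℝ) ^ (1 / 2 : ℝ)) := by gcongr
              _ = _ := by ring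
        _ = N := by
            rw [← Real.rpow_add hNpos]
            norm_num
    exact_mod_cast h3
  have hmain1 : C * (1 / √Q) ≤ t ^ 2 / 4 := by
    have h1 : 4 * C / t ^ 2 ≤ √Q := by
      refine Real.le_sqrt_of_sq_le (le_trans (le_of_eq ?_) hQge)
      rw [div_pow, mul_pow, ← pow_mul]
      norm_num
    have h2 : 0 < √(Q : ℝ) := Real.sqrt_pos.2 (by exact_mod_cast hQ1)
    rw [div_le_iff₀ (by positivity)] at h1
    rw [mul_one_div, div_le_div_iff₀ h2 (by norm_num)]
    linarith
  have hmain2 : C * ((R : ℝ) ^ 8 / N) ≤ t ^ 2 / 4 := by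
    have h1 := pow_eight_div_le hN hRA
    have h2 : (N : ℝ) ^ (-(1 / 8) : ℝ) ≤ t ^ 2 := by
      calc (N : ℝ) ^ (-(1 / 8) : ℝ) ≤ (N : ℝ) ^ (-(1 / (8 * (D + 1))) * 2 : ℝ) := by
            refine Real.rpow_le_rpow_of_exponent_le hNr ?_
            have hD' : (1 : ℝ) ≤ D := by exact_mod_cast hD
            have : 1 / (8 * ((D : ℝ) + 1)) ≤ 1 / 16 :=
              one_div_le_one_div_of_le (by norm_num) (by linarith)
            linarith
        _ = ((N : ℝ) ^ (-(1 / (8 * (D + 1))) : ℝ)) ^ 2 := by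
            rw [Real.rpow_mul hNpos.le]
            norm_cast
        _ ≤ _ := by gcongr
    -- The spare power 3/40 = 1/5 - 1/8 absorbs the constant 4CA⁸ once N ≥ N₀.
    have h3 : (N : ℝ) ^ (-(1 / 8) : ℝ) =
        (N : ℝ) ^ (3 / 40 : ℝ) * (N : ℝ) ^ (-(1 / 5) : ℝ) := by
      rw [← Real.rpow_add hNpos]
      norm_num
    have h4 : 0 ≤ (N : ℝ) ^ (-(1 / 5) : ℝ) := by positivity
    calc C * ((R : ℝ) ^ 8 / N) ≤ C * (A ^ 8 * (N : ℝ) ^ (-(1 / 5) : ℝ)) := by gcongr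
      _ = (4 * C * A ^ 8) * (N : ℝ) ^ (-(1 / 5) : ℝ) / 4 := by ring
      _ ≤ (N : ℝ) ^ (3 / 40 : ℝ) * (N : ℝ) ^ (-(1 / 5) : ℝ) / 4 := by gcongr
      _ ≤ t ^ 2 / 4 := by rw [← h3]; gcongr
  obtain ⟨x, hx, hdual⟩ := exists_sq_sum_norm_extOp_le hγ R N c M
  obtain ⟨H, hH0, hH, hX⟩ := h a b hγ R Q N hR hQ1 hN hQB M hM x hx
  set V := weightedMean a b R N c with hVdef
  set X := (N : ℝ)⁻¹ * ∑ n ∈ Finset.Icc 1 N,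
    β a b R (n : ℤ) * ‖∑ m ∈ M, x m * e (n * -((m : ℝ) / N))‖ ^ 2 with hXdef
  have hlow : J * (t * √V) ≤ ∑ m ∈ M, ‖extOp a b R N c (-((m : ℝ) / N))‖ := by
    rw [hJdef, ← nsmul_eq_mul]
    exact Finset.card_nsmul_le_sum _ _ _ hlev
  have hJt : J ^ 2 * t ^ 2 ≤ X := by
    have h1 : (J * (t * √V)) ^ 2 ≤ V * X := (pow_le_pow_left₀ (by positivity) hlow 2).trans hdual
    rw [mul_pow, mul_pow, Real.sq_sqrt hV.le] at h1
    refine le_of_mul_le_mul_left ?_ hV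
    linarith
  have hJH : J ^ 2 * t ^ 2 / 2 ≤ H := by
    have h1 : C * (1 / √Q + (R : ℝ) ^ 8 / N) ≤ t ^ 2 / 2 := by linarith
    have h2 : C * (1 / √Q + (R : ℝ) ^ 8 / N) * J ^ 2 ≤ t ^ 2 / 2 * J ^ 2 := by gcongr
    linarith
  have hfin : (J ^ 2 * t ^ 2 / 2) ^ (D + 1) ≤ C * (17 * C ^ 2 / t ^ 4) * J ^ (D + 1 + 1) := by
    refine (pow_le_pow_left₀ (by positivity) hJH _).trans (hH.trans ?_)
    gcongr
  have e1 : (J ^ 2 * t ^ 2 / 2) ^ (D + 1) =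
      J ^ D * t ^ (2 * D + 6) * (J ^ (D + 2) / (2 ^ (D + 1) * t ^ 4)) := by
    rw [div_pow, mul_pow, ← pow_mul, ← pow_mul, eq_comm, mul_div_assoc', div_eq_div_iff
      (by positivity) (by positivity)]
    ring
  have e2 : C * (17 * C ^ 2 / t ^ 4) * J ^ (D + 1 + 1) =
      2 ^ (D + 1) * (17 * C ^ 3) * (J ^ (D + 2) / (2 ^ (D + 1) * t ^ 4)) := by
    field_simp
  rw [e1, e2] at hfin
  exact le_of_mul_le_mul_right hfin (by positivity)

/-- Where F(n) ≠ 0 the root divisors are divisors of an integer of polynomial size in N, so the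
divisor bound applies. The bound on the coefficients enters here. -/
theorem exists_β_le_rpow (hk : 1 ≤ k) {A : ℝ} (hA : 0 < A) {ε : ℝ} (hε : 0 < ε) :
    ∃ C : ℝ, 0 < C ∧ ∀ N R : ℕ, 1 ≤ N → 1 ≤ R → (R : ℝ) ≤ A * (N : ℝ) ^ (1 / 10 : ℝ) →
      ∀ a b : Fin k → ℤ, (∀ q : ℕ, 1 ≤ q → 0 < γ a b q) →
      (∀ j, |a j| ≤ (N : ℤ) ∧ |b j| ≤ (N : ℤ)) →
      ∀ n ∈ Finset.Icc 1 N, F a b (n : ℤ) ≠ 0 → β a b R (n : ℤ) ≤ C * (N : ℝ) ^ ε := by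
  have hk0 : (0 : ℝ) < k := by exact_mod_cast hk
  -- As |F(n)| ≤ 2^k N^{2k}, the divisor count is O(N^{ε/4}); it is squared in β, and G(R) takes the
  -- remaining N^{ε/2}.
  set δ : ℝ := ε / (8 * k) with hδ
  have hδ0 : 0 < δ := by positivity
  obtain ⟨C₁, hC₁, h₁⟩ := exists_pow_card_primeFactors_le 2 (by norm_num) δ hδ0
  obtain ⟨C₂, hC₂, h₂⟩ := exists_G_le hk (ε / 2) (by positivity)
  refine ⟨(C₁ * ((2 : ℝ) ^ k) ^ δ) ^ 2 * (C₂ * A ^ (ε / 2)), by positivity,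
    fun N R hN hR hRA a b hγ hab n hn hF => ?_⟩
  have hNr : (1 : ℝ) ≤ N := by exact_mod_cast hN
  have hNpos : (0 : ℝ) < N := by linarith
  rw [Finset.mem_Icc] at hn
  have hFle : ((F a b (n : ℤ)).natAbs : ℝ) ≤ 2 ^ k * ((N : ℝ) ^ 2) ^ k := by
    have h1 : |F a b (n : ℤ)| ≤ ∏ _j : Fin k, (2 * (N : ℤ) ^ 2) := by
      rw [F, Finset.abs_prod]
      refine Finset.prod_le_prod (fun _ _ => abs_nonneg _) fun j _ => ?_
      have hn1 : |(n : ℤ)| ≤ N := by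
        rw [abs_of_nonneg (by positivity)]
        exact_mod_cast hn.2
      have hN1 : (1 : ℤ) ≤ N := by exact_mod_cast hN
      calc |a j * (n : ℤ) + b j| ≤ |a j| * |(n : ℤ)| + |b j| := by
            rw [← abs_mul]; exact abs_add_le _ _
        _ ≤ N * N + N := add_le_add (mul_le_mul (hab j).1 hn1 (abs_nonneg _) (by positivity))
            (hab j).2
        _ ≤ 2 * (N : ℤ) ^ 2 := by nlinarith
    rw [Finset.prod_const, Finset.card_univ, Fintype.card_fin, mul_pow] at h1
    have h2 : ((F a b (n : ℤ)).natAbs : ℤ) ≤ 2 ^ k * ((N : ℤ) ^ 2) ^ k := by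
      rwa [Int.natCast_natAbs]
    exact_mod_cast h2
  have hτ : ((rootDivisors a b R n).card : ℝ) ≤ C₁ * ((2 : ℝ) ^ k) ^ δ * (N : ℝ) ^ (ε / 4) := by
    have h1 := card_squarefree_dvd_le (s := rootDivisors a b R n) (Int.natAbs_ne_zero.2 hF)
      fun d hd => ⟨(Finset.mem_filter.1 hd).2.1, Int.natCast_dvd.1 (Finset.mem_filter.1 hd).2.2⟩
    calc ((rootDivisors a b R n).card : ℝ)
        ≤ 2 ^ (F a b (n : ℤ)).natAbs.primeFactors.card := by exact_mod_cast h1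
      _ ≤ C₁ * ((F a b (n : ℤ)).natAbs : ℝ) ^ δ := h₁ _ (Int.natAbs_ne_zero.2 hF)
      _ ≤ C₁ * (2 ^ k * ((N : ℝ) ^ 2) ^ k) ^ δ := by gcongr
      _ = C₁ * ((2 : ℝ) ^ k) ^ δ * (N : ℝ) ^ (ε / 4) := by
          rw [Real.mul_rpow (by positivity) (by positivity), ← mul_assoc, ← pow_mul,
            ← Real.rpow_natCast (N : ℝ), ← Real.rpow_mul hNpos.le]
          congr 2
          rw [hδ]
          push_cast
          field_simp
          norm_num
  have hG : G a b R ≤ C₂ * A ^ (ε / 2) * (N : ℝ) ^ (ε / 2) := by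
    calc G a b R ≤ C₂ * (R : ℝ) ^ (ε / 2) := h₂ a b hγ R hR
      _ ≤ C₂ * (A * N) ^ (ε / 2) := by
          gcongr
          refine hRA.trans ?_
          gcongr
          calc (N : ℝ) ^ (1 / 10 : ℝ) ≤ (N : ℝ) ^ (1 : ℝ) :=
                Real.rpow_le_rpow_of_exponent_le hNr (by norm_num)
            _ = N := Real.rpow_one _
      _ = _ := by rw [Real.mul_rpow hA.le hNpos.le, mul_assoc]
  have hG0 : 0 ≤ G a b R := zero_le_one.trans (one_le_G hγ hR)
  calc β a b R (n : ℤ) ≤ ((rootDivisors a b R n).card : ℝ) ^ 2 * G a b R := β_le hγ hR n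
    _ ≤ (C₁ * ((2 : ℝ) ^ k) ^ δ * (N : ℝ) ^ (ε / 4)) ^ 2 *
        (C₂ * A ^ (ε / 2) * (N : ℝ) ^ (ε / 2)) := by gcongr
    _ = (C₁ * ((2 : ℝ) ^ k) ^ δ) ^ 2 * (C₂ * A ^ (ε / 2)) *
        ((N : ℝ) ^ (ε / 4) * (N : ℝ) ^ (ε / 4) * (N : ℝ) ^ (ε / 2)) := by ring
    _ = _ := by
        rw [← Real.rpow_add hNpos, ← Real.rpow_add hNpos]
        congr 2
        ring

/-- Parseval produces β²; one factor is replaced by its supremum, the zeros of F being harmless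
because c vanishes there. -/
theorem sum_norm_extOp_sq_le {a b : Fin k → ℤ} (hγ : ∀ q : ℕ, 1 ≤ q → 0 < γ a b q) {R N : ℕ}
    (hN : 1 ≤ N) {c : ℕ → ℂ} (hc : ∀ n ∈ Finset.Icc 1 N, F a b (n : ℤ) = 0 → c n = 0) {S : ℝ}
    (hS : ∀ n ∈ Finset.Icc 1 N, F a b (n : ℤ) ≠ 0 → β a b R (n : ℤ) ≤ S) :
    ∑ m ∈ Finset.range N, ‖extOp a b R N c (-((m : ℝ) / N))‖ ^ 2 ≤
      S * weightedMean a b R N c := by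
  have hN0 : (0 : ℝ) < N := by exact_mod_cast hN
  have h1 : ∑ m ∈ Finset.range N, ‖extOp a b R N c (-((m : ℝ) / N))‖ ^ 2 =
      (N : ℝ)⁻¹ * ∑ n ∈ Finset.Icc 1 N, ‖c n * (β a b R (n : ℤ) : ℂ)‖ ^ 2 := by
    simp_rw [extOp, norm_mul (N : ℂ)⁻¹, mul_pow, ← Finset.mul_sum]
    rw [sum_norm_sq_fourier hN fun n => c n * (β a b R (n : ℤ) : ℂ), norm_inv,
      Complex.norm_natCast]
    field_simp
  rw [h1, weightedMean, mul_left_comm]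
  refine mul_le_mul_of_nonneg_left ?_ (by positivity)
  rw [Finset.mul_sum]
  refine Finset.sum_le_sum fun n hn => ?_
  have hβ := β_nonneg hγ R (n : ℤ)
  rw [norm_mul, Complex.norm_real, Real.norm_of_nonneg hβ, mul_pow]
  by_cases hF : F a b (n : ℤ) = 0
  · simp [hc n hn hF]
  · calc ‖c n‖ ^ 2 * β a b R (n : ℤ) ^ 2 = β a b R (n : ℤ) * (‖c n‖ ^ 2 * β a b R (n : ℤ)) := by
          ring
      _ ≤ S * (‖c n‖ ^ 2 * β a b R (n : ℤ)) := by
          gcongr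
          exact hS n hn hF

end

section

variable {k : ℕ}

/-- The `L^p` extension estimate on `ℤ/Nℤ`. -/
theorem exists_sum_norm_extOp_rpow_le (hk : 1 ≤ k) {p : ℝ} (hp : 2 < p) {A : ℝ} (hA : 0 < A) :
    ∃ C : ℝ, 0 < C ∧ ∀ N R : ℕ, 1 ≤ N → 1 ≤ R → (R : ℝ) ≤ A * (N : ℝ) ^ (1 / 10 : ℝ) →
      ∀ a b : Fin k → ℤ, (∀ q : ℕ, 1 ≤ q → 0 < γ a b q) →
      (∀ j, |a j| ≤ (N : ℤ) ∧ |b j| ≤ (N : ℤ)) →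
      ∀ c : ℕ → ℂ, (∀ n ∈ Finset.Icc 1 N, F a b (n : ℤ) = 0 → c n = 0) →
        ∑ m ∈ Finset.range N, ‖extOp a b R N c (-((m : ℝ) / N))‖ ^ p ≤
          (C * √(weightedMean a b R N c)) ^ p := by
  -- This makes the weak-type exponent r = 2 + 6/D smaller than p.
  obtain ⟨D, hD⟩ := exists_nat_gt (6 / (p - 2))
  have hp2 : 0 < p - 2 := by linarith
  have hD0 : (0 : ℝ) < D := lt_trans (by positivity) hD
  have hD1 : 1 ≤ D := by exact_mod_cast hD0
  set r : ℝ := (2 * D + 6) / D with hr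
  have hr0 : 0 < r := by positivity
  have hpr : 1 < p / r := by
    rw [lt_div_iff₀ hr0, one_mul, hr, div_lt_iff₀ hD0]
    rw [div_lt_iff₀ hp2] at hD
    linarith
  set δ : ℝ := 1 / (8 * ((D : ℝ) + 1)) with hδ
  have hδ0 : 0 < δ := by positivity
  obtain ⟨U, hU, hsup⟩ := exists_norm_extOp_sq_le hk hA
  obtain ⟨K, N₀, hK, hlevel⟩ := exists_card_level_set_le hk (A := A) hD1
  obtain ⟨S, hS, hβ⟩ := exists_β_le_rpow hk hA (ε := δ * (p - 2)) (by positivity)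
  obtain ⟨Z, hZ, hsum⟩ := exists_sum_rpow_neg_le hpr
  set K₂ : ℝ := K * U ^ (2 * D + 6) with hK₂
  have hK₂1 : 1 ≤ K₂ := one_le_mul_of_one_le_of_one_le hK (one_le_pow₀ hU)
  -- The three terms cover N < N₀, the values above N^{-δ}, and the values below N^{-δ}.
  set T : ℝ := N₀ * U ^ p + K₂ ^ (p / r) * Z + S with hT
  have hT0 : 0 < T := by positivity
  have hp0 : 0 < p := by linarith
  refine ⟨T ^ (1 / p), by positivity, fun N R hN hR hRA a b hγ hab c hc => ?_⟩
  have hNr : (1 : ℝ) ≤ N := by exact_mod_cast hN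
  have hNpos : (0 : ℝ) < N := by linarith
  set V := weightedMean a b R N c with hVdef
  have hV0 : 0 ≤ V := weightedMean_nonneg hγ R N c
  set f : ℕ → ℂ := fun m => extOp a b R N c (-((m : ℝ) / N)) with hf
  have hfsup : ∀ m < N, ‖f m‖ ^ 2 ≤ U * V := hsup N R hN hR hRA a b hγ c
  rcases hV0.eq_or_lt with hV | hV
  · have h1 : ∀ m ∈ Finset.range N, ‖f m‖ ^ p = 0 := by
      intro m hm
      have h2 := hfsup m (Finset.mem_range.1 hm)
      rw [← hV, mul_zero] at h2
      have h3 : ‖f m‖ = 0 := by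
        have := pow_eq_zero_iff (two_ne_zero) |>.1 (le_antisymm h2 (by positivity))
        exact this
      rw [h3, Real.zero_rpow hp0.ne']
    rw [Finset.sum_eq_zero h1]
    positivity
  have hsV : 0 < √V := Real.sqrt_pos.2 hV
  set y : ℕ → ℝ := fun m => ‖f m‖ / √V with hy
  have hy0 : ∀ m, 0 ≤ y m := fun m => by positivity
  have hfy : ∀ m, ‖f m‖ = y m * √V := fun m => (div_mul_cancel₀ _ hsV.ne').symm
  have hyU : ∀ m < N, y m ≤ U := by
    intro m hm
    have h1 := hfsup m hm
    rw [hfy, mul_pow, Real.sq_sqrt hV0] at h1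
    have h2 : y m ^ 2 ≤ U := le_of_mul_le_mul_right h1 hV
    by_contra! h3
    nlinarith
  suffices h : ∑ m ∈ Finset.range N, y m ^ p ≤ T by
    have h1 : ∀ m ∈ Finset.range N, ‖f m‖ ^ p = y m ^ p * √V ^ p := fun m _ => by
      rw [hfy, Real.mul_rpow (hy0 m) hsV.le]
    rw [Finset.sum_congr rfl h1, ← Finset.sum_mul, Real.mul_rpow (by positivity) hsV.le,
      ← Real.rpow_mul hT0.le, one_div_mul_cancel hp0.ne', Real.rpow_one]
    gcongr
  have hU0 : 0 ≤ U := by linarith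
  rcases lt_or_ge N N₀ with hNN₀ | hNN₀
  · calc ∑ m ∈ Finset.range N, y m ^ p ≤ ∑ _m ∈ Finset.range N, U ^ p := by
          refine Finset.sum_le_sum fun m hm => ?_
          exact Real.rpow_le_rpow (hy0 m) (hyU m (Finset.mem_range.1 hm)) hp0.le
      _ = N * U ^ p := by simp
      _ ≤ N₀ * U ^ p := by gcongr
      _ ≤ T := by
          have h1 : 0 ≤ K₂ ^ (p / r) * Z := by positivity
          linarith
  set t₀ : ℝ := (N : ℝ) ^ (-δ) with ht₀
  have ht₀0 : 0 < t₀ := by positivity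
  have ht₀1 : t₀ ≤ 1 := Real.rpow_le_one_of_one_le_of_nonpos hNr (by linarith)
  set big := (Finset.range N).filter fun m => t₀ ≤ y m with hbig
  have hbigsum : ∑ m ∈ big, y m ^ p ≤ K₂ ^ (p / r) * Z := by
    refine (sum_rpow_le_of_weak hr0 hp0 (by linarith : 0 ≤ K₂) big (fun m _ => hy0 m) ?_).trans ?_
    · intro m hm
      have hm' := Finset.mem_filter.1 hm
      have hmU := hyU m (Finset.mem_range.1 hm'.1)
      have hym : 0 < y m := ht₀0.trans_le hm'.2
      set M := big.filter fun m' => y m ≤ y m' with hM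
      -- The level-set bound needs t ≤ 1; since y m ≤ U, truncating at 1 costs only the factor
      -- U^{2D+6} in K₂.
      have h1 := hlevel N R hN hNN₀ hR hRA a b hγ c hV (min (y m) 1) (lt_min hym one_pos)
        (min_le_right _ _) (le_min hm'.2 ht₀1) M
        ((Finset.filter_subset _ _).trans (Finset.filter_subset _ _)) fun m' hm' => by
          have h2 := (Finset.mem_filter.1 hm').2
          refine le_trans ?_ (hfy m').ge
          gcongr
          exact (min_le_left _ _).trans h2
      have h2 : y m ≤ U * min (y m) 1 := by
        rcases le_total (y m) 1 with h | h
        · rw [min_eq_left h]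
          exact le_mul_of_one_le_left hym.le hU
        · rw [min_eq_right h, mul_one]
          exact hmU
      have h3 : (M.card : ℝ) ^ D * y m ^ (2 * D + 6) ≤ K₂ := by
        calc (M.card : ℝ) ^ D * y m ^ (2 * D + 6)
            ≤ (M.card : ℝ) ^ D * (U * min (y m) 1) ^ (2 * D + 6) :=
              mul_le_mul_of_nonneg_left (pow_le_pow_left₀ (hy0 m) h2 _)
                (pow_nonneg (Nat.cast_nonneg _) _)
          _ = (M.card : ℝ) ^ D * (min (y m) 1) ^ (2 * D + 6) * U ^ (2 * D + 6) := by
              rw [mul_pow]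
              ring
          _ ≤ K * U ^ (2 * D + 6) :=
              mul_le_mul_of_nonneg_right h1 (pow_nonneg hU0 _)
      have h4 : ((M.card : ℝ) * y m ^ r) ^ D = (M.card : ℝ) ^ D * y m ^ (2 * D + 6) := by
        rw [mul_pow, ← Real.rpow_mul_natCast hym.le, hr, div_mul_cancel₀ _ hD0.ne',
          ← Real.rpow_natCast (y m) (2 * D + 6)]
        push_cast
        rfl
      rw [← h4] at h3
      -- Because K₂ ≥ 1, the D-th root can be taken without changing the constant.
      by_contra! h5
      have h6 : 1 ≤ (M.card : ℝ) * y m ^ r := hK₂1.trans h5.le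
      have h7 := le_self_pow₀ h6 (by omega : D ≠ 0)
      linarith
    · have : 0 ≤ K₂ ^ (p / r) := by positivity
      gcongr
      exact hsum _
  have hsmall : ∑ m ∈ (Finset.range N).filter (fun m => ¬ t₀ ≤ y m), y m ^ p ≤ S := by
    have h1 : ∑ m ∈ Finset.range N, y m ^ 2 ≤ S * (N : ℝ) ^ (δ * (p - 2)) := by
      have h2 := sum_norm_extOp_sq_le hγ hN hc (hβ N R hN hR hRA a b hγ hab)
      have h3 : ∀ m ∈ Finset.range N, y m ^ 2 = ‖f m‖ ^ 2 / V := fun m _ => by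
        rw [hy, div_pow, Real.sq_sqrt hV0]
      rw [Finset.sum_congr rfl h3, ← Finset.sum_div, div_le_iff₀ hV]
      exact h2
    calc _ ≤ ∑ m ∈ (Finset.range N).filter (fun m => ¬ t₀ ≤ y m), t₀ ^ (p - 2) * y m ^ 2 := by
          refine Finset.sum_le_sum fun m hm => ?_
          have h2 := (not_le.1 (Finset.mem_filter.1 hm).2).le
          have h3 : y m ^ p = y m ^ (p - 2) * y m ^ 2 := by
            rcases (hy0 m).eq_or_lt with h | h
            · rw [← h, Real.zero_rpow hp0.ne']
              simp
            · rw [← Real.rpow_natCast (y m) 2, ← Real.rpow_add h]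
              congr 1
              push_cast
              ring
          rw [h3]
          have := hy0 m
          gcongr
      _ ≤ t₀ ^ (p - 2) * ∑ m ∈ Finset.range N, y m ^ 2 := by
          rw [← Finset.mul_sum]
          gcongr
          exact Finset.filter_subset _ _
      _ ≤ t₀ ^ (p - 2) * (S * (N : ℝ) ^ (δ * (p - 2))) := by gcongr
      _ = S * ((N : ℝ) ^ (-δ * (p - 2)) * (N : ℝ) ^ (δ * (p - 2))) := by
          rw [ht₀, ← Real.rpow_mul hNpos.le]
          ring
      _ = S := by
          rw [← Real.rpow_add hNpos]
          simp
  rw [← Finset.sum_filter_add_sum_filter_not (Finset.range N) fun m => t₀ ≤ y m]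
  have h1 : 0 ≤ (N₀ : ℝ) * U ^ p := by positivity
  linarith

/-! ### From ℤ/Nℤ to the circle -/

theorem extOp_sub (a b : Fin k → ℤ) (R N : ℕ) (c : ℕ → ℂ) (x t : ℝ) :
    extOp a b R N c (x - t) = extOp a b R N (fun n => c n * e (n * -t)) x := by
  simp only [extOp]
  congr 1
  refine Finset.sum_congr rfl fun n _ => ?_
  rw [sub_eq_add_neg, mul_add, e_add]
  ring

theorem weightedMean_mul_e (a b : Fin k → ℤ) (R N : ℕ) (c : ℕ → ℂ) (t : ℝ) :
    weightedMean a b R N (fun n => c n * e (n * -t)) = weightedMean a b R N c := by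
  simp [weightedMean, norm_e]

theorem continuous_extOp (a b : Fin k → ℤ) (R N : ℕ) (c : ℕ → ℂ) :
    Continuous (extOp a b R N c) := by
  unfold extOp e
  fun_prop

theorem extOp_one_sub (a b : Fin k → ℤ) (R N : ℕ) (c : ℕ → ℂ) (x : ℝ) :
    extOp a b R N c (1 - x) = extOp a b R N c (-x) := by
  simp only [extOp]
  congr 1
  refine Finset.sum_congr rfl fun n _ => ?_
  rw [sub_eq_add_neg, mul_add, e_add, mul_one, e_natCast, one_mul]

/-- The average of a continuous function over the circle through averages over cosets of the
`N`-th roots of unity. -/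
theorem integral_eq_integral_sum {g : ℝ → ℝ} (hg : Continuous g) {N : ℕ} (hN : 1 ≤ N) :
    ∫ θ in (0 : ℝ)..1, g θ =
      ∫ t in (0 : ℝ)..(N : ℝ)⁻¹, ∑ m ∈ Finset.range N, g ((m : ℝ) / N + t) := by
  have hN0 : (N : ℝ) ≠ 0 := by
    have : N ≠ 0 := by omega
    exact_mod_cast this
  have hint : ∀ m ∈ Finset.range N, IntervalIntegrable (fun t => g ((m : ℝ) / N + t))
      MeasureTheory.volume 0 (N : ℝ)⁻¹ := fun m _ =>
    (hg.comp (by fun_prop : Continuous fun t : ℝ => (m : ℝ) / N + t)).intervalIntegrable _ _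
  rw [intervalIntegral.integral_finsetSum hint]
  have h1 := intervalIntegral.sum_integral_adjacent_intervals (f := g)
    (μ := MeasureTheory.volume) (a := fun m : ℕ => (m : ℝ) / N) (n := N)
    fun m _ => hg.intervalIntegrable _ _
  simp only [Nat.cast_zero, zero_div, div_self hN0] at h1
  rw [← h1]
  refine Finset.sum_congr rfl fun m _ => ?_
  rw [intervalIntegral.integral_comp_add_left]
  congr 1
  · simp
  · push_cast
    ring

end

end EnvelopingSieve

open EnvelopingSieve in
theorem proposition4p2 (k : ℕ) (hk : 1 ≤ k) (p : ℝ) (hp : 2 < p) (A : ℝ) (hA : 0 < A) :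
    ∃ C : ℝ, 0 < C ∧
      ∀ (N R : ℕ), 1 ≤ N → 1 ≤ R → (R : ℝ) ≤ A * (N : ℝ) ^ (1 / 10 : ℝ) →
      ∀ (a b : Fin k → ℤ), (∀ j, a j ≠ 0) → discr a b ≠ 0 →
        (∀ q : ℕ, 1 ≤ q → 0 < EnvelopingSieve.γ a b q) →
        (∀ j, |a j| ≤ (N : ℤ) ∧ |b j| ≤ (N : ℤ)) →
      ∀ c : ℕ → ℂ, (∀ n ∈ Finset.Icc 1 N, F a b (n : ℤ) = 0 → c n = 0) →
        (∑ m ∈ Finset.range N, ‖extOp a b R N c (-((m : ℝ) / N))‖ ^ p) ^ (1 / p)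
            ≤ C * weightedNorm a b R N c ∧
        (∫ θ in (0 : ℝ)..1, ‖extOp a b R N c θ‖ ^ p) ^ (1 / p)
            ≤ C * (N : ℝ) ^ (-(1 / p)) * weightedNorm a b R N c := by
  obtain ⟨C, hC, h⟩ := exists_sum_norm_extOp_rpow_le hk hp hA
  refine ⟨C, hC, fun N R hN hR hRA a b _ _ hγ hab c hc => ?_⟩
  have hp0 : 0 < p := by linarith
  have hNpos : (0 : ℝ) < N := by exact_mod_cast hN
  have hnorm : weightedNorm a b R N c = √(weightedMean a b R N c) := by
    rw [Real.sqrt_eq_rpow]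
    rfl
  have hroot : ∀ x : ℝ, 0 ≤ x → (x ^ p) ^ (1 / p) = x := fun x hx => by
    rw [← Real.rpow_mul hx, mul_one_div_cancel hp0.ne', Real.rpow_one]
  rw [hnorm]
  set V := weightedMean a b R N c with hV
  have hCV : 0 ≤ C * √V := by positivity
  constructor
  · rw [← hroot _ hCV]
    exact Real.rpow_le_rpow (Finset.sum_nonneg fun m _ => by positivity)
      (h N R hN hR hRA a b hγ hab c hc) (by positivity)
  · have hcont : Continuous fun θ => ‖extOp a b R N c (-θ)‖ ^ p :=
      ((continuous_extOp a b R N c).comp continuous_neg).norm.rpow_const fun _ => Or.inr hp0.le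
    -- The discrete estimate lives at the frequencies -m/N, so the circle is first reflected.
    have h1 : ∫ θ in (0 : ℝ)..1, ‖extOp a b R N c θ‖ ^ p =
        ∫ θ in (0 : ℝ)..1, ‖extOp a b R N c (-θ)‖ ^ p := by
      have := intervalIntegral.integral_comp_sub_left (a := 0) (b := 1)
        (fun θ => ‖extOp a b R N c θ‖ ^ p) (1 : ℝ)
      simp only [sub_self, sub_zero] at this
      rw [← this]
      simp_rw [extOp_one_sub]
    have h2 : ∫ θ in (0 : ℝ)..1, ‖extOp a b R N c θ‖ ^ p ≤ (N : ℝ)⁻¹ * (C * √V) ^ p := by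
      rw [h1, integral_eq_integral_sum hcont hN]
      have h3 : ∀ t : ℝ, ∑ m ∈ Finset.range N, ‖extOp a b R N c (-((m : ℝ) / N + t))‖ ^ p ≤
          (C * √V) ^ p := by
        intro t
        -- Translation by t is absorbed into c without changing |c n| or its zeros, so the bound is
        -- uniform in t; integrating over an interval of length 1/N yields the factor N^{-1/p}.
        have h4 := h N R hN hR hRA a b hγ hab (fun n => c n * e (n * -t)) fun n hn hF => by
          rw [hc n hn hF, zero_mul]
        rw [weightedMean_mul_e] at h4
        simp_rw [← extOp_sub] at h4
        simp_rw [neg_add, ← sub_eq_add_neg]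
        exact h4
      have hsumcont : Continuous fun t : ℝ =>
          ∑ m ∈ Finset.range N, ‖extOp a b R N c (-((m : ℝ) / N + t))‖ ^ p :=
        continuous_finsetSum _ fun m _ => hcont.comp
          (by fun_prop : Continuous fun t : ℝ => (m : ℝ) / N + t)
      have h5 := intervalIntegral.integral_mono_on (a := 0) (b := (N : ℝ)⁻¹)
        (μ := MeasureTheory.volume) (by positivity)
        (hsumcont.intervalIntegrable _ _)
        (intervalIntegrable_const (c := (C * √V) ^ p)) fun t _ => h3 t
      rw [intervalIntegral.integral_const, sub_zero, smul_eq_mul] at h5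
      exact h5
    calc (∫ θ in (0 : ℝ)..1, ‖extOp a b R N c θ‖ ^ p) ^ (1 / p)
        ≤ ((N : ℝ)⁻¹ * (C * √V) ^ p) ^ (1 / p) := by
          refine Real.rpow_le_rpow ?_ h2 (by positivity)
          exact intervalIntegral.integral_nonneg zero_le_one fun θ _ => by positivity
      _ = (N : ℝ) ^ (-(1 / p)) * (C * √V) := by
          rw [Real.mul_rpow (by positivity) (by positivity), hroot _ hCV,
            Real.inv_rpow hNpos.le, Real.rpow_neg hNpos.le]
      _ = C * (N : ℝ) ^ (-(1 / p)) * √V := by ring
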